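/- \textbf{Worst-Case Values and Quantiles of General Distortions.} Let $U$ be uniform on $(0,1)$. For a distribution function $G$ on $\mathbb R$ with finite second moment let $G^{-1}(u)=\inf\{y: G(y)\ge u\}$, $0<u<1$, be its quantile function, and let $d_W(G_1,G_2)=\inf\{(\mathbb E(X_1-X_2)^2)^{1/2}: X_1\sim G_1,\,X_2\sim G_2\}$ be the Wasserstein distance of order 2; we also write $d_W(G_1^{-1},G_2^{-1})$. Let $g:[0,1]\to[0,1]$ be non-decreasing and absolutely continuous with $g(0)=0$, $g(1)=1$, let $$H_g(G)=-\int_{-\infty}^0 \bigl(1-g(1-G(x))\bigr)\,dx+\int_0^\infty g(1-G(x))\,dx ,$$ and let $\gamma(u)=\partial_-g(x)|_{x=1-u}$, $0<u<1$ (left derivative). Assume $\int_0^1\gamma^2\,du<\infty$ and $\gamma\not\equiv 1$. Let $F$ be a reference distribution with mean $\mu_F$ and variance $\sigma_F^2\in(0,\infty)$. For $\mu\in\mathbb R$, $\sigma>0$ and $0\le\varepsilon\le+\infty$ let $\mathcal M_\varepsilon(\mu,\sigma)$ be the set of distributions $G$ with mean $\mu$, standard deviation $\sigma$ and $d_W(F,G)\le\sqrt\varepsilon$.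 Put $m=(\mu_F-\mu)^2+(\sigma_F-\sigma)^2$. Let $\mathcal K$ be the set of square-integrable, non-decreasing, left-continuous functions on $(0,1)$. For $\lambda\ge0$ let $k_\lambda^\uparrow$ be the isotonic projection of $\gamma+\lambda F^{-1}$, i.e. the unique minimiser of $\|\gamma+\lambda F^{-1}-k\|_{L^2}$ over $k\in\mathcal K$, and write $\gamma^\uparrow=k_0^\uparrow$. Assume that $\lambda^\uparrow:=\inf\{\lambda\ge 0: k_\lambda^\uparrow\text{ is not constant}\}$ (with $\inf\emptyset=+\infty$) equals $0$. Whenever $k_\lambda^\uparrow$ is not constant let $$h_\lambda^\uparrow(u)=\mu+\sigma\,\frac{k_\lambda^\uparrow(u)-\mathbb E\,k_\lambda^\uparrow(U)}{\mathrm{std}(k_\lambda^\uparrow(U))},\qquad 0<u<1 .$$ Then the limit $c_0=\lim_{\lambda\searrow0}\mathrm{corr}(F^{-1}(U),k_\lambda^\uparrow(U))$ exists, and the following hold. 1. If $m<\varepsilon<m+2\sigma\sigma_F(1-c_0)$, then there is a unique $\lambda=\lambda(\varepsilon)>0$ with $d_W(F^{-1},h_\lambda^\uparrow)=\sqrt\varepsilon$;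 the distribution with quantile function $h_\lambda^\uparrow$ is the unique maximiser of $H_g$ over $\mathcal M_\varepsilon(\mu,\sigma)$; and the worst-case value is $$\sup_{G\in\mathcal M_\varepsilon(\mu,\sigma)}H_g(G)=H_g(h_\lambda^\uparrow)=\mu+\sigma\,\mathrm{std}(\gamma(U))\,\mathrm{corr}\bigl(\gamma(U),k_\lambda^\uparrow(U)\bigr),$$ which is continuous in $\varepsilon$ on this range. 2. Let $\varepsilon>m$ and $\varepsilon\ge m+2\sigma\sigma_F(1-c_0)$. If $\gamma^\uparrow$ is not constant, then the distribution with quantile function $h_0^\uparrow$ is the unique maximiser of $H_g$ over $\mathcal M_\varepsilon(\mu,\sigma)$, and the worst-case value is $H_g(h_0^\uparrow)=\mu+\sigma\,\mathrm{std}(\gamma(U))\,\mathrm{corr}(\gamma(U),\gamma^\uparrow(U))$. If $\gamma^\uparrow$ is constant, then $\sup_{G\in\mathcal M_\varepsilon(\mu,\sigma)}H_g(G)=\mu$. This supremum need not be attained: for all $\mu\in\mathbb R$ and $\sigma>0$ there are $g$ and $F$ satisfying all the assumptions above, with $\gamma^\uparrow$ constant, such that for every $\varepsilon$ as in case 2 no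 $G\in\mathcal M_\varepsilon(\mu,\sigma)$ attains it. -/

import Mathlib

open MeasureTheory ProbabilityTheory Set Filter Topology
open scoped ENNReal

namespace WorstCase

noncomputable section

/-! ### Distributions, quantile functions, distortion risk measures -/

/-- The law of a standard uniform random variable `U` on `(0, 1)`. -/
def unif : Measure ℝ := volume.restrict (Ioo (0 : ℝ) 1)

/-- `G` is a probability distribution on `ℝ` with finite second moment, mean `μ` and second
moment `μ ^ 2 + σ ^ 2`. -/
structure HasMoments (G : Measure ℝ) (μ σ : ℝ) : Prop where
  prob : IsProbabilityMeasure G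
  sq_integrable : MemLp (fun x : ℝ => x) 2 G
  mean : ∫ x, x ∂G = μ
  second : ∫ x, x ^ 2 ∂G = μ ^ 2 + σ ^ 2

/-- The (left-continuous) quantile function `G⁻¹(u) = inf {y | u ≤ G(y)}`, for `0 < u < 1`. -/
def quantile (G : Measure ℝ) (u : ℝ) : ℝ := sInf {y : ℝ | u ≤ cdf G y}

/-- The distribution of `h(U)`, that is, the distribution with quantile function `h` when `h` is
non-decreasing and left-continuous on `(0, 1)`. -/
def law (h : ℝ → ℝ) : Measure ℝ := unif.map h

/-- Distortion functions on `[0, 1]` (values of `g` outside `[0, 1]` play no role). -/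
structure IsDistortion (g : ℝ → ℝ) : Prop where
  mono : MonotoneOn g (Icc 0 1)
  zero : g 0 = 0
  one : g 1 = 1

/-- The distortion risk measure as a Choquet integral,
`-∫_{-∞}^0 (1 - g (1 - G x)) dx + ∫_0^∞ g (1 - G x) dx`. Both integrands are non-negative, and
the integrals are allowed to be infinite. -/
def riskMeasure (g : ℝ → ℝ) (G : Measure ℝ) : EReal :=
  ((∫⁻ x in Ioi (0 : ℝ), ENNReal.ofReal (g (1 - cdf G x)) : ℝ≥0∞) : EReal) -
    ((∫⁻ x in Iio (0 : ℝ), ENNReal.ofReal (1 - g (1 - cdf G x)) : ℝ≥0∞) : EReal)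

/-- The weight function `γ(u)`: the left derivative of `g` at `1 - u`. -/
def weight (g : ℝ → ℝ) (u : ℝ) : ℝ := derivWithin g (Iic (1 - u)) (1 - u)

/-! ### Wasserstein distance and the uncertainty set -/

/-- The set of bivariate distributions with marginals `G₁` and `G₂`. -/
def couplings (G₁ G₂ : Measure ℝ) : Set (Measure (ℝ × ℝ)) :=
  {π | π.map Prod.fst = G₁ ∧ π.map Prod.snd = G₂}

/-- The Wasserstein distance of order 2: the infimum of `(E (X₁ - X₂)²) ^ (1/2)` over all
couplings. -/
def dW (G₁ G₂ : Measure ℝ) : ℝ≥0∞ :=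
  ⨅ π ∈ couplings G₁ G₂, eLpNorm (fun z : ℝ × ℝ => z.1 - z.2) 2 π

/-- The uncertainty set: moments given by `μ`, `σ`, within Wasserstein distance `√ε` of `F`. -/
def uncertaintySet (F : Measure ℝ) (μ σ : ℝ) (ε : ℝ≥0∞) : Set (Measure ℝ) :=
  {G | HasMoments G μ σ ∧ dW F G ≤ ε ^ (1 / 2 : ℝ)}

/-- The worst-case value. -/
def worstValue (g : ℝ → ℝ) (F : Measure ℝ) (μ σ : ℝ) (ε : ℝ≥0∞) : EReal :=
  ⨆ G ∈ uncertaintySet F μ σ ε, riskMeasure g G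

/-- The set of worst-case distributions. -/
def worstDistributions (g : ℝ → ℝ) (F : Measure ℝ) (μ σ : ℝ) (ε : ℝ≥0∞) : Set (Measure ℝ) :=
  {G | G ∈ uncertaintySet F μ σ ε ∧
    ∀ G' ∈ uncertaintySet F μ σ ε, riskMeasure g G' ≤ riskMeasure g G}

/-! ### Moments of functions of `U` -/

/-- `E (f U)`. -/
def meanU (f : ℝ → ℝ) : ℝ := ∫ u, f u ∂unif

/-- `std (f U)`. -/
def stdU (f : ℝ → ℝ) : ℝ := Real.sqrt (variance f unif)

/-- `corr (f₁ U, f₂ U)`. -/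
def corrU (f₁ f₂ : ℝ → ℝ) : ℝ := covariance f₁ f₂ unif / (stdU f₁ * stdU f₂)

/-! ### Isotonic projection -/

/-- The set `𝒦` of square-integrable, non-decreasing, left-continuous functions on `(0, 1)`
(values outside `(0, 1)` play no role). -/
structure IsIsotonic (k : ℝ → ℝ) : Prop where
  sq_integrable : MemLp k 2 unif
  mono : MonotoneOn k (Ioo 0 1)
  left_cont : ∀ u ∈ Ioo (0 : ℝ) 1, ContinuousWithinAt k (Iic u) u

/-- `k` minimises the `L²` distance to `f` over `𝒦`. -/
def IsIsotonicProjection (f k : ℝ → ℝ) : Prop :=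
  IsIsotonic k ∧
    ∀ k', IsIsotonic k' → ∫ u, (f u - k u) ^ 2 ∂unif ≤ ∫ u, (f u - k' u) ^ 2 ∂unif

/-- The isotonic projection of `f`. -/
def isotonicProjection (f : ℝ → ℝ) : ℝ → ℝ :=
  Classical.epsilon (IsIsotonicProjection f)

/-- The function `γ + l F⁻¹`. -/
def tilted (g : ℝ → ℝ) (F : Measure ℝ) (l : ℝ) : ℝ → ℝ :=
  fun u => weight g u + l * quantile F u

/-- `k_l^↑`, the isotonic projection of `γ + l F⁻¹`. -/
def kUp (g : ℝ → ℝ) (F : Measure ℝ) (l : ℝ) : ℝ → ℝ := isotonicProjection (tilted g F l)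

/-- `k` is constant on `(0, 1)`. -/
def IsConstant (k : ℝ → ℝ) : Prop := ∃ c : ℝ, ∀ u ∈ Ioo (0 : ℝ) 1, k u = c

/-- `λ^↑ = inf {l ≥ 0 | k_l^↑ is not constant}`, with `inf ∅ = +∞`. -/
def lambdaUp (g : ℝ → ℝ) (F : Measure ℝ) : EReal :=
  sInf ((fun l : ℝ => (l : EReal)) '' {l : ℝ | 0 ≤ l ∧ ¬ IsConstant (kUp g F l)})

/-- `h_l^↑`, the standardised version of `k_l^↑` with mean `μ` and standard deviation `σ`. -/
def hUp (g : ℝ → ℝ) (F : Measure ℝ) (μ σ l : ℝ) : ℝ → ℝ :=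
  fun u => μ + σ * ((kUp g F l u - meanU (kUp g F l)) / stdU (kUp g F l))

/-- `c₀`, the limit of `corr (F⁻¹(U), k_l^↑(U))` as `l ↓ 0`. -/
def cZero (g : ℝ → ℝ) (F : Measure ℝ) : ℝ :=
  limUnder (𝓝[>] (0 : ℝ)) (fun l : ℝ => corrU (quantile F) (kUp g F l))

/-- The lower critical value `(μ_F - μ)² + (σ_F - σ)²` of `ε`. -/
def lowerCrit (μF σF μ σ : ℝ) : ℝ := (μF - μ) ^ 2 + (σF - σ) ^ 2

/-- The upper critical value `(μ_F - μ)² + (σ_F - σ)² + 2 σ σ_F (1 - c₀)` of `ε`. -/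
def upperCrit (g : ℝ → ℝ) (F : Measure ℝ) (μF σF μ σ : ℝ) : ℝ :=
  lowerCrit μF σF μ σ + 2 * σ * σF * (1 - cZero g F)

/-- The standing assumptions on the distortion function `g` and the reference distribution `F`:
`g` is an absolutely continuous distortion function with square-integrable weight function
`γ ≠ 1`, `F` has mean `μF` and standard deviation `σF > 0`, and `λ^↑ = 0`. -/
structure Setting (g : ℝ → ℝ) (F : Measure ℝ) (μF σF : ℝ) : Prop where
  distortion : IsDistortion g
  abs_cont : AbsolutelyContinuousOnInterval g 0 1
  weight_sq : MemLp (weight g) 2 unif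
  weight_ne_one : ∃ u ∈ Ioo (0 : ℝ) 1, weight g u ≠ 1
  moments : HasMoments F μF σF
  sigma_pos : 0 < σF
  lambdaUp_eq : lambdaUp g F = 0

/-- For the distribution with quantile function `h_l^↑`: it has this quantile function indeed, it
is the unique worst-case distribution at tolerance `ε`, and the worst-case value, which it attains,
equals `μ + σ std(γ(U)) corr(γ(U), k_l^↑(U))`. -/
def Solves (g : ℝ → ℝ) (F : Measure ℝ) (μ σ : ℝ) (ε : ℝ≥0∞) (l : ℝ) : Prop :=
  EqOn (quantile (law (hUp g F μ σ l))) (hUp g F μ σ l) (Ioo 0 1) ∧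
  worstDistributions g F μ σ ε = {law (hUp g F μ σ l)} ∧
  worstValue g F μ σ ε = riskMeasure g (law (hUp g F μ σ l)) ∧
  riskMeasure g (law (hUp g F μ σ l)) =
    ((μ + σ * stdU (weight g) * corrU (weight g) (kUp g F l) : ℝ) : EReal)

end

end WorstCase

open WorstCase

open scoped InnerProductSpace

namespace WorstCase

/-! ### Quantile functions -/

/-! Quantile functions move the problem to `L²(0,1)`. The comonotone coupling is optimal, so `dW` is
the `L²` distance of quantile functions (`dW_eq`), and Tonelli turns the Choquet integral into `∫ γ
G⁻¹` (`riskMeasure_eq`). With `γ`, `φ`, `w` the centred versions of the weight, `F⁻¹` and `G⁻¹`, the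
task is to maximise `⟪γ, w⟫` over the vectors `w` of norm `σ` in the closed convex cone `isoCone` of
centred monotone functions, under a lower bound on `⟪φ, w⟫`. By Pythagoras the isotonic projection
is, up to its mean, the metric projection on this cone.

Optimality is a Lagrangian argument. If `k_l` is the projection of `γ + l φ`, then `⟪γ + l φ, w⟫ ≤
⟪k_l, w⟫ ≤ ‖k_l‖ σ` on the cone, with equality throughout only for the positive multiple of `k_l`
that has norm `σ`. Hence `h_l` is the unique maximiser as soon as it is feasible and either `l = 0`
or the constraint is tight (`Setting.solves`).

It remains to hit the prescribed cosine of `φ` and `k_l`. It is continuous and non-decreasing in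
`l`, with limits `c₀` at `0` and `1` at infinity. Uniqueness of `l` is the delicate point: two equal
cosines put both projections on one ray, and then the projection has to stay on that ray all the way
down to `l = 0`, so that the common value is `c₀` (`IsTiltedFamily.eq_of_cosine_eq`). This uses the
order structure of the cone: when two projections lie on the ray of `v`, a suitable `φ - C v`
integrates to zero over the level sets of `v` and is monotone on each of them, hence pairs
non-negatively with every monotone function (`inner_nonneg_of_isConeProj_smul`).

If `γ^↑` is constant, `γ` lies in the polar cone, so no value exceeds `μ`; the `h_l` approach `μ` as
`l ↓ 0`. For the weight `1 + (1 - u)(1 - 3u)` and uniform `F`, `γ` pairs strictly negatively with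
every non-constant monotone function, so `μ` is not attained. -/

instance isProbabilityMeasure_unif : IsProbabilityMeasure unif :=
  ⟨by simp [unif]⟩

lemma ae_unif_mem : ∀ᵐ u ∂unif, u ∈ Ioo (0 : ℝ) 1 :=
  ae_restrict_mem measurableSet_Ioo

lemma unif_apply (s : Set ℝ) : unif s = volume (s ∩ Ioo 0 1) := by
  rw [unif, Measure.restrict_apply' measurableSet_Ioo]

lemma unif_Iic {c : ℝ} (h1 : c ≤ 1) : unif (Iic c) = ENNReal.ofReal c := by
  have h : unif (Iio c) = ENNReal.ofReal c := by
    have : Iio c ∩ Ioo 0 1 = Ioo 0 c := by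
      ext x
      simp only [mem_inter_iff, mem_Iio, mem_Ioo]
      constructor
      · rintro ⟨a, b, d⟩; exact ⟨b, a⟩
      · rintro ⟨a, b⟩; exact ⟨b, a, by linarith⟩
    rw [unif_apply, this, Real.volume_Ioo, sub_zero]
  have hn : NullSingletonClass unif := by unfold unif; infer_instance
  rw [← h]
  exact (measure_congr Iio_ae_eq_Iic).symm

lemma aemeasurable_of_monotoneOn {h : ℝ → ℝ} (hh : MonotoneOn h (Ioo 0 1)) :
    AEMeasurable h unif :=
  aemeasurable_restrict_of_monotoneOn measurableSet_Ioo hh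

/-- The infimum is attained because the cdf is right-continuous. This Galois connection is the only
property of the infimum used later. -/
lemma quantile_le_iff {G : Measure ℝ} {u : ℝ} (hu : u ∈ Ioo (0 : ℝ) 1) (x : ℝ) :
    quantile G u ≤ x ↔ u ≤ cdf G x := by
  have hne : {y : ℝ | u ≤ cdf G y}.Nonempty := by
    obtain ⟨y, hy⟩ := ((tendsto_cdf_atTop G).eventually (lt_mem_nhds hu.2)).exists
    exact ⟨y, hy.le⟩
  have hbdd : BddBelow {y : ℝ | u ≤ cdf G y} := by
    obtain ⟨y, hy⟩ := ((tendsto_cdf_atBot G).eventually (gt_mem_nhds hu.1)).exists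
    refine ⟨y, fun z hz => ?_⟩
    by_contra! hlt
    exact absurd (hz.trans (monotone_cdf G hlt.le)) (not_le.2 hy)
  refine ⟨fun h => ?_, fun h => csInf_le hbdd h⟩
  have hgt : ∀ y, x < y → u ≤ cdf G y := by
    intro y hy
    obtain ⟨z, hz, hzy⟩ := exists_lt_of_csInf_lt hne (lt_of_le_of_lt h hy)
    exact le_trans hz (monotone_cdf G hzy.le)
  have hc : Tendsto (cdf G) (𝓝[>] x) (𝓝 (cdf G x)) :=
    ((cdf G).right_continuous x).tendsto.mono_left (nhdsWithin_mono _ Ioi_subset_Ici_self)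
  exact ge_of_tendsto hc (eventually_nhdsWithin_of_forall hgt)

lemma lt_quantile_iff {G : Measure ℝ} {u : ℝ} (hu : u ∈ Ioo (0 : ℝ) 1) (x : ℝ) :
    x < quantile G u ↔ cdf G x < u := by
  rw [← not_le, ← not_le, quantile_le_iff hu]

lemma monotoneOn_quantile (G : Measure ℝ) : MonotoneOn (quantile G) (Ioo 0 1) := by
  intro u hu v hv huv
  rw [quantile_le_iff hu]
  exact huv.trans ((quantile_le_iff hv _).1 le_rfl)

lemma aemeasurable_quantile (G : Measure ℝ) : AEMeasurable (quantile G) unif :=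
  aemeasurable_of_monotoneOn (monotoneOn_quantile G)

lemma continuousWithinAt_quantile (G : Measure ℝ) {u : ℝ} (hu : u ∈ Ioo (0 : ℝ) 1) :
    ContinuousWithinAt (quantile G) (Iic u) u := by
  have hnear : ∀ a < u, ∀ᶠ v in 𝓝[Iic u] u, v ∈ Ioo (0 : ℝ) 1 ∧ a < v ∧ v ≤ u := by
    intro a ha
    filter_upwards [self_mem_nhdsWithin, mem_nhdsWithin_of_mem_nhds (Ioi_mem_nhds hu.1),
      mem_nhdsWithin_of_mem_nhds (Ioi_mem_nhds ha)] with v h1 h2 h3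
    exact ⟨⟨h2, lt_of_le_of_lt h1 hu.2⟩, h3, h1⟩
  refine tendsto_order.2 ⟨fun y hy => ?_, fun y hy => ?_⟩
  · filter_upwards [hnear _ ((lt_quantile_iff hu y).1 hy)] with v hv
    exact (lt_quantile_iff hv.1 y).2 hv.2.1
  · filter_upwards [hnear 0 hu.1] with v hv
    exact lt_of_le_of_lt (monotoneOn_quantile G hv.1 hu hv.2.2) hy

lemma law_quantile (G : Measure ℝ) [IsProbabilityMeasure G] : law (quantile G) = G := by
  have : IsProbabilityMeasure (law (quantile G)) :=
    Measure.isProbabilityMeasure_map (aemeasurable_quantile G)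
  refine Measure.ext_of_Iic _ _ fun x => ?_
  rw [law, Measure.map_apply_of_aemeasurable (aemeasurable_quantile G) measurableSet_Iic,
    ← ofReal_cdf, ← unif_Iic (cdf_le_one G x)]
  refine measure_congr ?_
  filter_upwards [ae_unif_mem] with u hu
  exact propext (quantile_le_iff hu x)

/-- Left continuity at the single point `u` suffices: if `x < h u`, then `h` already exceeds `x`
from some `b < u` on, so `{h ≤ x}` has mass at most `b`. -/
lemma quantile_law_apply {h : ℝ → ℝ} (hh : MonotoneOn h (Ioo 0 1)) {u : ℝ}
    (hu : u ∈ Ioo (0 : ℝ) 1) (hc : ContinuousWithinAt h (Iic u) u) :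
    quantile (law h) u = h u := by
  have hm := aemeasurable_of_monotoneOn hh
  have : IsProbabilityMeasure (law h) := Measure.isProbabilityMeasure_map hm
  have key : ∀ x, quantile (law h) u ≤ x ↔ h u ≤ x := by
    intro x
    have hcdf : cdf (law h) x = unif.real {v | h v ≤ x} := by
      rw [cdf_eq_real, measureReal_def, law,
        Measure.map_apply_of_aemeasurable hm measurableSet_Iic]
      rfl
    rw [quantile_le_iff hu, hcdf]
    constructor
    · intro hle
      by_contra! hlt
      have hev := hc.tendsto.eventually (lt_mem_nhds hlt)
      obtain ⟨a, ha, hau⟩ := (mem_nhdsLE_iff_exists_Ioc_subset).1 hev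
      -- A point of `(a, u)` that is also positive, since `a` itself may be negative.
      set b := max ((a + u) / 2) (u / 2) with hb
      have hau' : a < u := ha
      have hb1 : a < b := lt_of_lt_of_le (by linarith) (le_max_left _ _)
      have hb2 : b < u := max_lt (by linarith) (by linarith [hu.1])
      have hb0 : 0 < b := lt_of_lt_of_le (by linarith [hu.1]) (le_max_right _ _)
      have hbm : x < h b := hau ⟨hb1, hb2.le⟩
      have hsub : unif {v | h v ≤ x} ≤ unif (Iic b) := by
        refine measure_mono_ae ?_
        filter_upwards [ae_unif_mem] with v hv hvx
        by_contra hbv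
        exact absurd (hh ⟨hb0, hb2.trans hu.2⟩ hv (not_le.1 hbv).le)
          (not_le.2 (lt_of_le_of_lt hvx hbm))
      have := ENNReal.toReal_mono (measure_ne_top _ _) hsub
      rw [unif_Iic (hb2.trans hu.2).le, ENNReal.toReal_ofReal hb0.le] at this
      exact absurd (hle.trans this) (not_le.2 hb2)
    · intro hle
      have hsub : unif (Iic u) ≤ unif {v | h v ≤ x} := by
        refine measure_mono_ae ?_
        filter_upwards [ae_unif_mem] with v hv hvu
        exact (hh hv hu hvu).trans hle
      have := ENNReal.toReal_mono (measure_ne_top _ _) hsub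
      rwa [unif_Iic hu.2.le, ENNReal.toReal_ofReal hu.1.le] at this
  exact le_antisymm ((key _).2 le_rfl) ((key _).1 le_rfl)

lemma quantile_law {h : ℝ → ℝ} (hh : IsIsotonic h) : EqOn (quantile (law h)) h (Ioo 0 1) :=
  fun u hu => quantile_law_apply hh.mono hu (hh.left_cont u hu)

/-- An isotonic function is the quantile function of its law, and the law sees only the
almost-everywhere class. -/
lemma IsIsotonic.eqOn_of_ae_eq {h k : ℝ → ℝ} (hh : IsIsotonic h) (hk : IsIsotonic k)
    (hhk : h =ᵐ[unif] k) : EqOn h k (Ioo 0 1) := by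
  have : law h = law k := Measure.map_congr hhk
  intro u hu
  rw [← quantile_law hh hu, ← quantile_law hk hu, this]

lemma isIsotonic_quantile_of_memLp {G : Measure ℝ} (hG : MemLp (quantile G) 2 unif) :
    IsIsotonic (quantile G) :=
  ⟨hG, monotoneOn_quantile G, fun _ hu => continuousWithinAt_quantile G hu⟩

/-- A monotone function has at most countably many discontinuities. -/
lemma quantile_law_ae_eq {h : ℝ → ℝ} (hh : MonotoneOn h (Ioo 0 1)) :
    quantile (law h) =ᵐ[unif] h := by
  have hcount := hh.countable_not_continuousWithinAt
  have hnull : NullSingletonClass unif := by unfold unif; infer_instance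
  have hz := hcount.measure_zero unif
  filter_upwards [ae_unif_mem, measure_eq_zero_iff_ae_notMem.1 hz] with u hu hu'
  have hcont : ContinuousWithinAt h (Ioo 0 1) u := by
    by_contra hcon
    exact hu' ⟨hu, hcon⟩
  exact quantile_law_apply hh hu (hcont.continuousAt (Ioo_mem_nhds hu.1 hu.2)).continuousWithinAt

/-- A square-integrable monotone function agrees almost everywhere with a left-continuous one. -/
lemma exists_isIsotonic_ae_eq {h : ℝ → ℝ} (hh : MonotoneOn h (Ioo 0 1)) (h2 : MemLp h 2 unif) :
    ∃ k, IsIsotonic k ∧ k =ᵐ[unif] h :=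
  ⟨quantile (law h), isIsotonic_quantile_of_memLp (h2.ae_eq (quantile_law_ae_eq hh).symm),
    quantile_law_ae_eq hh⟩

lemma HasMoments.isIsotonic {G : Measure ℝ} {μ σ : ℝ} (hG : HasMoments G μ σ) :
    IsIsotonic (quantile G) := by
  have := hG.prob
  refine ⟨?_, monotoneOn_quantile G, fun u hu => continuousWithinAt_quantile G hu⟩
  have h := hG.sq_integrable
  rw [← law_quantile G, law] at h
  exact (memLp_map_measure_iff (g := id) aestronglyMeasurable_id (aemeasurable_quantile G)).1 h

lemma integral_law {h : ℝ → ℝ} (hm : AEMeasurable h unif) {f : ℝ → ℝ} (hf : Continuous f) :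
    ∫ x, f x ∂law h = ∫ u, f (h u) ∂unif :=
  integral_map hm hf.aestronglyMeasurable

lemma HasMoments.meanU_quantile {G : Measure ℝ} {μ σ : ℝ} (hG : HasMoments G μ σ) :
    meanU (quantile G) = μ := by
  have := hG.prob
  rw [← hG.mean]
  conv_rhs => rw [← law_quantile G]
  exact (integral_law (aemeasurable_quantile G) continuous_id).symm

lemma HasMoments.variance_quantile {G : Measure ℝ} {μ σ : ℝ} (hG : HasMoments G μ σ) :
    variance (quantile G) unif = σ ^ 2 := by
  have := hG.prob
  have h2 : ∫ u, quantile G u ^ 2 ∂unif = μ ^ 2 + σ ^ 2 := by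
    rw [← hG.second]
    conv_rhs => rw [← law_quantile G]
    exact (integral_law (aemeasurable_quantile G) (continuous_pow 2)).symm
  have h1 := hG.meanU_quantile
  rw [meanU] at h1
  rw [variance_eq_sub hG.isIsotonic.sq_integrable]
  simp only [Pi.pow_apply]
  rw [h2, h1]; ring

lemma hasMoments_law {h : ℝ → ℝ} {μ σ : ℝ} (hh : MemLp h 2 unif) (hm : meanU h = μ)
    (hv : variance h unif = σ ^ 2) : HasMoments (law h) μ σ := by
  have ham := hh.aestronglyMeasurable.aemeasurable
  refine ⟨Measure.isProbabilityMeasure_map ham, ?_, ?_, ?_⟩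
  · exact (memLp_map_measure_iff aestronglyMeasurable_id ham).2 hh
  · rw [← hm]; exact integral_law ham continuous_id
  · rw [integral_law ham (continuous_pow 2)]
    rw [variance_eq_sub hh] at hv
    simp only [Pi.pow_apply] at hv
    rw [meanU] at hm
    rw [hm] at hv
    linarith

/-! ### The Wasserstein distance in terms of quantile functions -/

/-- One of the two intervals is empty. Areas of squares allow Tonelli to express the transport cost
through probabilities of crossing events. -/
lemma enorm_sub_sq (x y : ℝ) :
    ‖x - y‖ₑ ^ 2 = volume (Ico x y) * volume (Ico x y) + volume (Ico y x) * volume (Ico y x) := by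
  rw [Real.volume_Ico, Real.volume_Ico]
  rcases le_total x y with h | h
  · rw [ENNReal.ofReal_of_nonpos (sub_nonpos.2 h), mul_zero, add_zero, ← pow_two,
      ← Real.enorm_of_nonneg (sub_nonneg.2 h), enorm_sub_rev]
  · rw [ENNReal.ofReal_of_nonpos (sub_nonpos.2 h), mul_zero, zero_add, ← pow_two,
      ← Real.enorm_of_nonneg (sub_nonneg.2 h)]

lemma prod_Ico_eq (x y : ℝ) : Ico x y ×ˢ Ico x y =
    {p : ℝ × ℝ | x ≤ min p.1 p.2 ∧ max p.1 p.2 < y} := by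
  ext p
  simp only [mem_prod, mem_Ico, mem_ofPred_eq, le_min_iff, max_lt_iff]
  tauto

lemma measurableSet_crossing {α : Type*} [MeasurableSpace α] {f a b g : α → ℝ}
    (hf : Measurable f) (ha : Measurable a) (hb : Measurable b) (hg : Measurable g) :
    MeasurableSet {q | f q ≤ a q ∧ b q < g q} := by
  rw [Set.ofPred_and]
  exact (measurableSet_le hf ha).inter (measurableSet_lt hb hg)

/-- The squared distance under a coupling, as an integral of crossing probabilities. -/
lemma lintegral_enorm_sub_sq (π : Measure (ℝ × ℝ)) [IsProbabilityMeasure π] :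
    ∫⁻ z, ‖z.1 - z.2‖ₑ ^ 2 ∂π = ∫⁻ p : ℝ × ℝ,
      (π {z | z.1 ≤ min p.1 p.2 ∧ max p.1 p.2 < z.2} +
        π {z | z.2 ≤ min p.1 p.2 ∧ max p.1 p.2 < z.1}) := by
  set A : Set ((ℝ × ℝ) × (ℝ × ℝ)) :=
    {q | q.1.1 ≤ min q.2.1 q.2.2 ∧ max q.2.1 q.2.2 < q.1.2} with hA
  set B : Set ((ℝ × ℝ) × (ℝ × ℝ)) :=
    {q | q.1.2 ≤ min q.2.1 q.2.2 ∧ max q.2.1 q.2.2 < q.1.1} with hB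
  have mA : MeasurableSet A :=
    measurableSet_crossing (by fun_prop) (by fun_prop) (by fun_prop) (by fun_prop)
  have mB : MeasurableSet B :=
    measurableSet_crossing (by fun_prop) (by fun_prop) (by fun_prop) (by fun_prop)
  have h1 : ∀ z : ℝ × ℝ, ‖z.1 - z.2‖ₑ ^ 2 =
      volume (Prod.mk z ⁻¹' A) + volume (Prod.mk z ⁻¹' B) := by
    intro z
    have e1 : Prod.mk z ⁻¹' A = Ico z.1 z.2 ×ˢ Ico z.1 z.2 := by
      rw [prod_Ico_eq]; rfl
    have e2 : Prod.mk z ⁻¹' B = Ico z.2 z.1 ×ˢ Ico z.2 z.1 := by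
      rw [prod_Ico_eq]; rfl
    rw [enorm_sub_sq, e1, e2, Measure.volume_eq_prod, Measure.prod_prod, Measure.prod_prod]
  simp_rw [h1]
  rw [lintegral_add_left (measurable_measure_prodMk_left mA), ← Measure.prod_apply mA,
    ← Measure.prod_apply mB, Measure.prod_apply_symm mA, Measure.prod_apply_symm mB,
    ← lintegral_add_left (measurable_measure_prodMk_right mA)]
  rfl

/-- Union bound: `z.1 ≤ a` forces `z.2 ≤ b` or a crossing. The bound depends on the marginals only.
-/
lemma measure_crossing_ge {F G : Measure ℝ} {π : Measure (ℝ × ℝ)} (h : π ∈ couplings F G)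
    (a b : ℝ) : F (Iic a) - G (Iic b) ≤ π {z | z.1 ≤ a ∧ b < z.2} := by
  rw [← h.1, ← h.2, Measure.map_apply measurable_fst measurableSet_Iic,
    Measure.map_apply measurable_snd measurableSet_Iic, tsub_le_iff_right]
  refine (measure_mono ?_).trans (measure_union_le _ _)
  intro z hz
  by_cases hb : z.2 ≤ b
  · exact Or.inr hb
  · exact Or.inl ⟨hz, not_le.1 hb⟩

lemma couplings_swap {F G : Measure ℝ} {π : Measure (ℝ × ℝ)} (h : π ∈ couplings F G) :
    π.map Prod.swap ∈ couplings G F := by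
  refine ⟨?_, ?_⟩
  · rw [Measure.map_map measurable_fst measurable_swap]; exact h.2
  · rw [Measure.map_map measurable_snd measurable_swap]; exact h.1

lemma measure_crossing_ge' {F G : Measure ℝ} {π : Measure (ℝ × ℝ)} (h : π ∈ couplings F G)
    (a b : ℝ) : G (Iic a) - F (Iic b) ≤ π {z | z.2 ≤ a ∧ b < z.1} := by
  have := measure_crossing_ge (couplings_swap h) a b
  rwa [Measure.map_apply measurable_swap] at this
  exact measurableSet_crossing (by fun_prop) (by fun_prop) (by fun_prop) (by fun_prop)

/-- Under the quantile coupling the crossing event is, up to a null set, the interval from `G(b)` to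
`F(a)`, so the union bound is sharp. Truncated subtraction covers the case of an empty interval. -/
lemma unif_crossing (F G : Measure ℝ) [IsProbabilityMeasure F] [IsProbabilityMeasure G]
    (a b : ℝ) : unif {u | quantile F u ≤ a ∧ b < quantile G u} = F (Iic a) - G (Iic b) := by
  have e : unif {u | quantile F u ≤ a ∧ b < quantile G u} =
      unif (Iic (cdf F a) \ Iic (cdf G b)) := by
    refine measure_congr ?_
    filter_upwards [ae_unif_mem] with u hu
    refine propext ?_
    change (quantile F u ≤ a ∧ b < quantile G u) ↔ (u ≤ cdf F a ∧ ¬ u ≤ cdf G b)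
    rw [quantile_le_iff hu, lt_quantile_iff hu, not_le]
  rw [e, ← ofReal_cdf, ← ofReal_cdf, ← unif_Iic (cdf_le_one F a), ← unif_Iic (cdf_le_one G b)]
  rcases le_total (cdf F a) (cdf G b) with h | h
  · rw [sdiff_eq_empty.2 (Iic_subset_Iic.2 h), measure_empty, tsub_eq_zero_of_le]
    exact measure_mono (Iic_subset_Iic.2 h)
  · exact measure_sdiff (Iic_subset_Iic.2 h) measurableSet_Iic.nullMeasurableSet
      (measure_ne_top _ _)

lemma aemeasurable_quantile_pair (F G : Measure ℝ) :
    AEMeasurable (fun u => (quantile F u, quantile G u)) unif :=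
  (aemeasurable_quantile F).prodMk (aemeasurable_quantile G)

lemma map_quantile_pair_mem_couplings (F G : Measure ℝ) [IsProbabilityMeasure F]
    [IsProbabilityMeasure G] :
    unif.map (fun u => (quantile F u, quantile G u)) ∈ couplings F G := by
  refine ⟨?_, ?_⟩
  · rw [AEMeasurable.map_map_of_aemeasurable measurable_fst.aemeasurable
      (aemeasurable_quantile_pair F G)]
    exact law_quantile F
  · rw [AEMeasurable.map_map_of_aemeasurable measurable_snd.aemeasurable
      (aemeasurable_quantile_pair F G)]
    exact law_quantile G

lemma eLpNorm_two_eq {α : Type*} {m : MeasurableSpace α} (ν : Measure α) (f : α → ℝ) :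
    eLpNorm f 2 ν = (∫⁻ a, ‖f a‖ₑ ^ 2 ∂ν) ^ (1 / 2 : ℝ) := by
  rw [eLpNorm_eq_lintegral_rpow_enorm_toReal two_ne_zero ENNReal.ofNat_ne_top]
  simp

/-- The quantile coupling minimises all crossing probabilities at once, hence also their integral,
which is the squared cost. -/
lemma dW_eq (F G : Measure ℝ) [IsProbabilityMeasure F] [IsProbabilityMeasure G] :
    dW F G = eLpNorm (fun u => quantile F u - quantile G u) 2 unif := by
  have hmeas : Measurable fun z : ℝ × ℝ => z.1 - z.2 := by fun_prop
  have hpair := aemeasurable_quantile_pair F G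
  set π₀ := unif.map (fun u => (quantile F u, quantile G u)) with hπ₀
  have hmem : π₀ ∈ couplings F G := map_quantile_pair_mem_couplings F G
  have hp : IsProbabilityMeasure π₀ := Measure.isProbabilityMeasure_map hpair
  have h0 : eLpNorm (fun u => quantile F u - quantile G u) 2 unif =
      eLpNorm (fun z : ℝ × ℝ => z.1 - z.2) 2 π₀ :=
    (eLpNorm_map_measure hmeas.aestronglyMeasurable hpair).symm
  rw [h0]
  refine le_antisymm (iInf₂_le π₀ hmem) (le_iInf₂ fun π hπ => ?_)
  have hprob : IsProbabilityMeasure π := by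
    refine ⟨?_⟩
    have := congrArg (fun ν => ν univ) hπ.1
    simpa [Measure.map_apply measurable_fst MeasurableSet.univ] using this
  rw [eLpNorm_two_eq, eLpNorm_two_eq]
  refine ENNReal.rpow_le_rpow ?_ (by norm_num)
  rw [lintegral_enorm_sub_sq, lintegral_enorm_sub_sq]
  refine lintegral_mono fun p => add_le_add ?_ ?_
  · refine le_trans (le_of_eq ?_) (measure_crossing_ge hπ _ _)
    rw [← unif_crossing, hπ₀, Measure.map_apply_of_aemeasurable hpair]
    · rfl
    · exact measurableSet_crossing (by fun_prop) (by fun_prop) (by fun_prop) (by fun_prop)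
  · refine le_trans (le_of_eq ?_) (measure_crossing_ge' hπ _ _)
    rw [← unif_crossing, hπ₀, Measure.map_apply_of_aemeasurable hpair]
    · rfl
    · exact measurableSet_crossing (by fun_prop) (by fun_prop) (by fun_prop) (by fun_prop)

/-! ### The risk measure in terms of quantile functions -/

section Risk

variable {g : ℝ → ℝ}

/-- Monotonicity is known on `[0, 1]` only, so the half-line is first cut down to `[0, 1 - u]`,
which leaves the left derivative unchanged. -/
lemma weight_nonneg (hg : IsDistortion g) {u : ℝ} (hu : u ∈ Ioo (0 : ℝ) 1) : 0 ≤ weight g u := by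
  have hx : 0 < 1 - u := by linarith [hu.2]
  have h : weight g u = derivWithin g (Icc 0 (1 - u)) (1 - u) := by
    rw [weight, ← Ici_inter_Iic, inter_comm]
    exact (derivWithin_inter (Ici_mem_nhds hx)).symm
  rw [h]
  exact MonotoneOn.derivWithin_nonneg (hg.mono.mono (Icc_subset_Icc_right (by linarith [hu.1])))

lemma weight_ae_eq (hac : AbsolutelyContinuousOnInterval g 0 1) :
    ∀ᵐ u, u ∈ Icc (0 : ℝ) 1 → weight g u = deriv g (1 - u) := by
  have hq := (Measure.measurePreserving_sub_left (volume : Measure ℝ) 1).quasiMeasurePreserving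
  filter_upwards [hq.ae hac.ae_differentiableAt] with u hu hmem
  have : DifferentiableAt ℝ g (1 - u) := hu (by
    rw [uIcc_of_le zero_le_one]
    exact ⟨by linarith [hmem.2], by linarith [hmem.1]⟩)
  exact this.derivWithin (uniqueDiffWithinAt_Iic _)

lemma intervalIntegral_weight (hac : AbsolutelyContinuousOnInterval g 0 1) {a b : ℝ}
    (ha : 0 ≤ a) (hab : a ≤ b) (hb : b ≤ 1) :
    ∫ u in a..b, weight g u = g (1 - a) - g (1 - b) := by
  have h1 : ∫ u in a..b, weight g u = ∫ u in a..b, deriv g (1 - u) := by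
    refine intervalIntegral.integral_congr_ae ?_
    filter_upwards [weight_ae_eq hac] with u hu hmem
    rw [uIoc_of_le hab] at hmem
    exact hu ⟨ha.trans hmem.1.le, hmem.2.trans hb⟩
  rw [h1, intervalIntegral.integral_comp_sub_left (fun x => deriv g x)]
  refine (hac.mono ?_).integral_deriv_eq_sub
  rw [uIcc_of_le zero_le_one, uIcc_of_le (by linarith)]
  exact Icc_subset_Icc (by linarith) (by linarith)

lemma integrable_weight (hw : MemLp (weight g) 2 unif) : Integrable (weight g) unif :=
  hw.integrable one_le_two

lemma lintegral_weight_Ioc (hg : IsDistortion g) (hac : AbsolutelyContinuousOnInterval g 0 1)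
    (hw : MemLp (weight g) 2 unif) {a b : ℝ} (ha : 0 ≤ a) (hab : a ≤ b) (hb : b ≤ 1) :
    ∫⁻ u in Ioc a b, ENNReal.ofReal (weight g u) ∂unif =
      ENNReal.ofReal (g (1 - a) - g (1 - b)) := by
  rw [← ofReal_integral_eq_lintegral_ofReal (integrable_weight hw).integrableOn
    (ae_restrict_of_ae (ae_unif_mem.mono fun u hu => weight_nonneg hg hu)),
    ← intervalIntegral_weight hac ha hab hb, intervalIntegral.integral_of_le hab]
  congr 1
  rw [unif, Measure.restrict_restrict measurableSet_Ioc]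
  refine setIntegral_congr_set ?_
  have : (Ioc a b ∩ Ioo 0 1 : Set ℝ) =ᵐ[volume] (Ioc a b ∩ Ioc 0 1 : Set ℝ) :=
    (ae_eq_refl _).inter Ioo_ae_eq_Ioc
  refine this.trans (Eq.eventuallyEq ?_)
  exact inter_eq_left.2 (Ioc_subset_Ioc ha hb)

lemma lintegral_weight_Ioi (hg : IsDistortion g) (hac : AbsolutelyContinuousOnInterval g 0 1)
    (hw : MemLp (weight g) 2 unif) {c : ℝ} (h0 : 0 ≤ c) (h1 : c ≤ 1) :
    ∫⁻ u in Ioi c, ENNReal.ofReal (weight g u) ∂unif = ENNReal.ofReal (g (1 - c)) := by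
  have := lintegral_weight_Ioc hg hac hw h0 h1 le_rfl
  rw [sub_self, hg.zero, sub_zero] at this
  rw [← this]
  refine setLIntegral_congr ?_
  filter_upwards [ae_unif_mem] with u hu
  exact propext ⟨fun h => ⟨h, hu.2.le⟩, fun h => h.1⟩

lemma lintegral_weight_Iic (hg : IsDistortion g) (hac : AbsolutelyContinuousOnInterval g 0 1)
    (hw : MemLp (weight g) 2 unif) {c : ℝ} (h0 : 0 ≤ c) (h1 : c ≤ 1) :
    ∫⁻ u in Iic c, ENNReal.ofReal (weight g u) ∂unif = ENNReal.ofReal (1 - g (1 - c)) := by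
  have := lintegral_weight_Ioc hg hac hw le_rfl h0 h1
  rw [sub_zero, hg.one] at this
  rw [← this]
  refine setLIntegral_congr ?_
  filter_upwards [ae_unif_mem] with u hu
  exact propext ⟨fun h => ⟨hu.1, h⟩, fun h => h.2⟩

lemma integral_weight (hg : IsDistortion g) (hac : AbsolutelyContinuousOnInterval g 0 1) :
    meanU (weight g) = 1 := by
  have := intervalIntegral_weight hac le_rfl zero_le_one le_rfl
  rw [sub_zero, sub_self, hg.zero, hg.one, sub_zero, intervalIntegral.integral_of_le zero_le_one]
    at this
  rw [meanU, unif, ← integral_Ioc_eq_integral_Ioo, this]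

/-- Tonelli's theorem for a weight on `(0, 1)` restricted to the sections of a measurable set. -/
lemma lintegral_sections {w : ℝ → ℝ≥0∞} (hw : AEMeasurable w unif) {A : Set (ℝ × ℝ)}
    (hA : MeasurableSet A) (s : Set ℝ) :
    ∫⁻ x in s, ∫⁻ u in {u | (x, u) ∈ A}, w u ∂unif =
      ∫⁻ u, w u * volume ({x | (x, u) ∈ A} ∩ s) ∂unif := by
  have hsec1 : ∀ x, MeasurableSet {u | (x, u) ∈ A} := fun x => measurable_prodMk_left hA
  have hsec2 : ∀ u, MeasurableSet {x | (x, u) ∈ A} := fun u => measurable_prodMk_right hA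
  have h1 : ∀ x, ∫⁻ u in {u | (x, u) ∈ A}, w u ∂unif =
      ∫⁻ u, A.indicator (fun z => w z.2) (x, u) ∂unif := by
    intro x
    rw [← lintegral_indicator (hsec1 x)]
    rfl
  simp_rw [h1]
  rw [lintegral_lintegral_swap (f := fun x u => A.indicator (fun z => w z.2) (x, u))]
  · refine lintegral_congr fun u => ?_
    have h2 : ∀ x, A.indicator (fun z => w z.2) (x, u) =
        {x | (x, u) ∈ A}.indicator (fun _ => w u) x := fun x => rfl
    simp_rw [h2]
    rw [lintegral_indicator (hsec2 u), setLIntegral_const, Measure.restrict_apply (hsec2 u)]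
  · exact (hw.comp_quasiMeasurePreserving Measure.quasiMeasurePreserving_snd).indicator hA

lemma measurable_cdf (G : Measure ℝ) : Measurable (cdf G) := (monotone_cdf G).measurable

/-- Each value of `g` is an integral of `γ` over a half-line of `u`. After Tonelli, `cdf G x < u ↔ x
< quantile G u` turns the sections in `x` into intervals with endpoints `0` and `quantile G u`. -/
lemma riskMeasure_eq (hg : IsDistortion g) (hac : AbsolutelyContinuousOnInterval g 0 1)
    (hw : MemLp (weight g) 2 unif) {G : Measure ℝ}
    (hq : MemLp (quantile G) 2 unif) :
    riskMeasure g G = ((∫ u, weight g u * quantile G u ∂unif : ℝ) : EReal) := by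
  have hwm : AEMeasurable (fun u => ENNReal.ofReal (weight g u)) unif :=
    hw.aestronglyMeasurable.aemeasurable.ennreal_ofReal
  have hpos : ∫⁻ x in Ioi (0 : ℝ), ENNReal.ofReal (g (1 - cdf G x)) =
      ∫⁻ u, ENNReal.ofReal (weight g u * quantile G u) ∂unif := by
    have hA : MeasurableSet {z : ℝ × ℝ | cdf G z.1 < z.2} :=
      measurableSet_lt ((measurable_cdf G).comp measurable_fst) measurable_snd
    have h1 : ∀ x, ENNReal.ofReal (g (1 - cdf G x)) =
        ∫⁻ u in {u | (x, u) ∈ {z : ℝ × ℝ | cdf G z.1 < z.2}}, ENNReal.ofReal (weight g u) ∂unif :=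
      fun x => (lintegral_weight_Ioi hg hac hw (cdf_nonneg G x) (cdf_le_one G x)).symm
    simp_rw [h1]
    rw [lintegral_sections hwm hA]
    refine lintegral_congr_ae ?_
    filter_upwards [ae_unif_mem] with u hu
    rw [ENNReal.ofReal_mul (weight_nonneg hg hu)]
    congr 1
    have : {x | cdf G x < u} ∩ Ioi 0 = Ioo 0 (quantile G u) := by
      ext x
      exact (and_congr_left' (lt_quantile_iff hu x).symm).trans and_comm
    rw [this, Real.volume_Ioo, sub_zero]
  have hneg : ∫⁻ x in Iio (0 : ℝ), ENNReal.ofReal (1 - g (1 - cdf G x)) =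
      ∫⁻ u, ENNReal.ofReal (-(weight g u * quantile G u)) ∂unif := by
    have hA : MeasurableSet {z : ℝ × ℝ | z.2 ≤ cdf G z.1} :=
      measurableSet_le measurable_snd ((measurable_cdf G).comp measurable_fst)
    have h1 : ∀ x, ENNReal.ofReal (1 - g (1 - cdf G x)) =
        ∫⁻ u in {u | (x, u) ∈ {z : ℝ × ℝ | z.2 ≤ cdf G z.1}}, ENNReal.ofReal (weight g u) ∂unif :=
      fun x => (lintegral_weight_Iic hg hac hw (cdf_nonneg G x) (cdf_le_one G x)).symm
    simp_rw [h1]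
    rw [lintegral_sections hwm hA]
    refine lintegral_congr_ae ?_
    filter_upwards [ae_unif_mem] with u hu
    rw [← mul_neg, ENNReal.ofReal_mul (weight_nonneg hg hu)]
    congr 1
    have : {x | u ≤ cdf G x} ∩ Iio 0 = Ico (quantile G u) 0 := by
      ext x
      exact and_congr_left' (quantile_le_iff hu x).symm
    rw [this, Real.volume_Ico, zero_sub]
  have hint : Integrable (fun u => weight g u * quantile G u) unif := hw.integrable_mul hq
  have f1 := hint.lintegral_lt_top.ne
  have f2 := hint.neg.lintegral_lt_top.ne
  rw [riskMeasure, hpos, hneg, integral_eq_lintegral_pos_part_sub_lintegral_neg_part hint,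
    EReal.coe_sub]
  congr 1
  · exact (EReal.coe_ennreal_toReal f1).symm
  · exact (EReal.coe_ennreal_toReal f2).symm

end Risk

/-! ### Projections on closed convex cones in a Hilbert space -/

section Cone

variable {H : Type*} [NormedAddCommGroup H] [InnerProductSpace ℝ H]

/-- `C` is a closed convex cone with apex `0`. -/
structure IsClosedConvexCone (C : Set H) : Prop where
  zero_mem : 0 ∈ C
  add_mem : ∀ x ∈ C, ∀ y ∈ C, x + y ∈ C
  smul_mem : ∀ a : ℝ, 0 ≤ a → ∀ x ∈ C, a • x ∈ C
  closed : IsClosed C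

/-- `v` is the metric projection of `z` on the cone `C`, in terms of the polar cone. -/
structure IsConeProj (C : Set H) (z v : H) : Prop where
  mem : v ∈ C
  inner_self : ⟪z - v, v⟫_ℝ = 0
  inner_nonpos : ∀ w ∈ C, ⟪z - v, w⟫_ℝ ≤ 0

variable {C : Set H}

lemma IsConeProj.inner_le {z v w : H} (h : IsConeProj C z v) (hw : w ∈ C) :
    ⟪z, w⟫_ℝ ≤ ⟪v, w⟫_ℝ := by
  have := h.inner_nonpos w hw
  rw [inner_sub_left] at this
  linarith

lemma IsConeProj.inner_eq {z v : H} (h : IsConeProj C z v) : ⟪z, v⟫_ℝ = ‖v‖ ^ 2 := by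
  have := h.inner_self
  rw [inner_sub_left, real_inner_self_eq_norm_sq] at this
  linarith

lemma IsClosedConvexCone.convex (hC : IsClosedConvexCone C) : Convex ℝ C :=
  fun x hx y hy a b ha hb _ => hC.add_mem _ (hC.smul_mem a ha x hx) _ (hC.smul_mem b hb y hy)

/-- Testing the variational inequality with `0` and `2v` gives orthogonality of the residual to `v`.
-/
lemma IsConeProj.of_inner_sub_nonpos (hC : IsClosedConvexCone C) {z v : H} (hv : v ∈ C)
    (h : ∀ w ∈ C, ⟪z - v, w - v⟫_ℝ ≤ 0) : IsConeProj C z v := by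
  have h1 := h 0 hC.zero_mem
  have h2 := h _ (hC.add_mem v hv v hv)
  rw [zero_sub, inner_neg_right] at h1
  rw [add_sub_cancel_right] at h2
  have h3 : ⟪z - v, v⟫_ℝ = 0 := by linarith
  refine ⟨hv, h3, fun w hw => ?_⟩
  have := h w hw
  rwa [inner_sub_right, h3, sub_zero] at this

lemma IsConeProj.of_forall_norm_le (hC : IsClosedConvexCone C) {z v : H} (hv : v ∈ C)
    (h : ∀ w ∈ C, ‖z - v‖ ≤ ‖z - w‖) : IsConeProj C z v := by
  refine .of_inner_sub_nonpos hC hv ((norm_eq_iInf_iff_real_inner_le_zero hC.convex hv).1 ?_)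
  have : Nonempty C := ⟨⟨v, hv⟩⟩
  refine le_antisymm (le_ciInf fun w => h w w.2) ?_
  exact ciInf_le (f := fun w : C => ‖z - w‖) ⟨0, by rintro _ ⟨w, rfl⟩; exact norm_nonneg _⟩ ⟨v, hv⟩

lemma exists_isConeProj [CompleteSpace H] (hC : IsClosedConvexCone C) (z : H) :
    ∃ v, IsConeProj C z v := by
  obtain ⟨v, hv, h⟩ := exists_norm_eq_iInf_of_complete_convex ⟨0, hC.zero_mem⟩
    hC.closed.isComplete hC.convex z
  exact ⟨v, .of_inner_sub_nonpos hC hv ((norm_eq_iInf_iff_real_inner_le_zero hC.convex hv).1 h)⟩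

/-- Pairing each residual with the other projection yields `‖v - v'‖² ≤ ⟪z - z', v - v'⟫`;
Cauchy-Schwarz does the rest. -/
lemma IsConeProj.norm_sub_le_norm_sub {z z' v v' : H} (h : IsConeProj C z v)
    (h' : IsConeProj C z' v') : ‖v - v'‖ ≤ ‖z - z'‖ := by
  have e1 := h.inner_le h'.mem
  have e2 := h'.inner_le h.mem
  have e3 := h.inner_eq
  have e4 := h'.inner_eq
  have e5 : ‖v - v'‖ ^ 2 ≤ ⟪z - z', v - v'⟫_ℝ := by
    rw [← real_inner_self_eq_norm_sq]
    simp only [inner_sub_left, inner_sub_right, real_inner_self_eq_norm_sq]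
    linarith [real_inner_comm v v']
  have e6 := e5.trans (real_inner_le_norm _ _)
  by_contra! hlt
  nlinarith [norm_nonneg (z - z')]

lemma IsConeProj.unique {z v v' : H} (h : IsConeProj C z v) (h' : IsConeProj C z v') :
    v = v' := by
  have := h.norm_sub_le_norm_sub h'
  rw [sub_self, norm_zero] at this
  exact sub_eq_zero.1 (norm_le_zero_iff.1 this)

lemma IsConeProj.norm_sub_sq_le {z v w : H} (h : IsConeProj C z v) (hw : w ∈ C) :
    ‖z - v‖ ^ 2 ≤ ‖z - w‖ ^ 2 := by
  have e : z - w = (z - v) + (v - w) := by abel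
  rw [e, norm_add_sq_real, inner_sub_right, h.inner_self]
  nlinarith [h.inner_nonpos w hw, sq_nonneg ‖v - w‖]

end Cone

/-! ### Centred functions as elements of the Hilbert space `L²` -/

/-- The element `f - E f(U)` of `L²(0, 1)`. -/
noncomputable def ctr (f : ℝ → ℝ) : Lp ℝ 2 unif :=
  open Classical in
  if h : MemLp f 2 unif then (h.sub (memLp_const (meanU f))).toLp _ else 0

lemma ctr_eq {f : ℝ → ℝ} (h : MemLp f 2 unif) :
    ctr f = (h.sub (memLp_const (meanU f))).toLp _ := dif_pos h

lemma coeFn_ctr {f : ℝ → ℝ} (h : MemLp f 2 unif) : ctr f =ᵐ[unif] fun u => f u - meanU f := by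
  rw [ctr_eq h]
  exact MemLp.coeFn_toLp _

lemma meanU_congr {f k : ℝ → ℝ} (h : f =ᵐ[unif] k) : meanU f = meanU k := integral_congr_ae h

lemma ctr_congr {f k : ℝ → ℝ} (h : f =ᵐ[unif] k) : ctr f = ctr k := by
  by_cases hf : MemLp f 2 unif
  · rw [ctr_eq hf, ctr_eq (hf.ae_eq h), MemLp.toLp_eq_toLp_iff, meanU_congr h]
    exact h.sub (ae_eq_refl _)
  · have hk : ¬ MemLp k 2 unif := fun hk => hf (hk.ae_eq h.symm)
    rw [ctr, ctr, dif_neg hf, dif_neg hk]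

lemma ctr_eq_iff {f k : ℝ → ℝ} (hf : MemLp f 2 unif) (hk : MemLp k 2 unif) :
    ctr f = ctr k ↔ f =ᵐ[unif] fun u => k u + (meanU f - meanU k) := by
  rw [ctr_eq hf, ctr_eq hk, MemLp.toLp_eq_toLp_iff]
  refine eventually_congr (Eventually.of_forall fun u => ?_)
  simp only [Pi.sub_apply]
  constructor <;> intro h <;> linarith

lemma integrable_of_memLp {f : ℝ → ℝ} (h : MemLp f 2 unif) : Integrable f unif :=
  h.integrable one_le_two

lemma meanU_const (c : ℝ) : meanU (fun _ => c) = c := by simp [meanU]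

lemma meanU_add {f k : ℝ → ℝ} (hf : MemLp f 2 unif) (hk : MemLp k 2 unif) :
    meanU (fun u => f u + k u) = meanU f + meanU k :=
  integral_add (integrable_of_memLp hf) (integrable_of_memLp hk)

lemma meanU_add_const {f : ℝ → ℝ} (hf : MemLp f 2 unif) (c : ℝ) :
    meanU (fun u => f u + c) = meanU f + c := by
  rw [meanU_add hf (memLp_const c), meanU_const]

lemma meanU_const_mul (f : ℝ → ℝ) (c : ℝ) : meanU (fun u => c * f u) = c * meanU f :=
  integral_const_mul _ _

lemma ctr_add {f k : ℝ → ℝ} (hf : MemLp f 2 unif) (hk : MemLp k 2 unif) :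
    ctr (fun u => f u + k u) = ctr f + ctr k := by
  rw [ctr_eq hf, ctr_eq hk, ctr_eq (f := fun u => f u + k u) (hf.add hk),
    ← MemLp.toLp_add, MemLp.toLp_eq_toLp_iff,
    meanU_add hf hk]
  refine Eventually.of_forall fun u => ?_
  simp only [Pi.sub_apply, Pi.add_apply]
  ring

lemma ctr_const_mul {f : ℝ → ℝ} (hf : MemLp f 2 unif) (c : ℝ) :
    ctr (fun u => c * f u) = c • ctr f := by
  rw [ctr_eq hf, ctr_eq (hf.const_mul c), ← MemLp.toLp_const_smul, MemLp.toLp_eq_toLp_iff,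
    meanU_const_mul]
  refine Eventually.of_forall fun u => ?_
  simp only [Pi.sub_apply, Pi.smul_apply, smul_eq_mul]
  ring

lemma ctr_const (c : ℝ) : ctr (fun _ => c) = 0 := by
  rw [ctr_eq (memLp_const c), ← MemLp.toLp_zero (MemLp.zero' (p := 2) (μ := unif) (ε := ℝ)),
    MemLp.toLp_eq_toLp_iff, meanU_const]
  refine Eventually.of_forall fun u => ?_
  simp

lemma ctr_add_const {f : ℝ → ℝ} (hf : MemLp f 2 unif) (c : ℝ) :
    ctr (fun u => f u + c) = ctr f := by
  rw [ctr_add hf (memLp_const c), ctr_const, add_zero]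

lemma inner_ctr {f k : ℝ → ℝ} (hf : MemLp f 2 unif) (hk : MemLp k 2 unif) :
    ⟪ctr f, ctr k⟫_ℝ = covariance f k unif := by
  rw [L2.inner_def, covariance]
  refine integral_congr_ae ?_
  filter_upwards [coeFn_ctr hf, coeFn_ctr hk] with u h1 h2
  rw [h1, h2]
  simp [meanU, mul_comm]

lemma inner_ctr_eq_sub {f k : ℝ → ℝ} (hf : MemLp f 2 unif) (hk : MemLp k 2 unif) :
    ⟪ctr f, ctr k⟫_ℝ = ∫ u, f u * k u ∂unif - meanU f * meanU k := by
  rw [inner_ctr hf hk, covariance_eq_sub hf hk]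
  rfl

lemma variance_eq_norm_sq {f : ℝ → ℝ} (hf : MemLp f 2 unif) : variance f unif = ‖ctr f‖ ^ 2 := by
  rw [← covariance_self hf.aestronglyMeasurable.aemeasurable, ← inner_ctr hf hf,
    real_inner_self_eq_norm_sq]

lemma stdU_eq {f : ℝ → ℝ} (hf : MemLp f 2 unif) : stdU f = ‖ctr f‖ := by
  rw [stdU, variance_eq_norm_sq hf, Real.sqrt_sq (norm_nonneg _)]

lemma corrU_eq {f k : ℝ → ℝ} (hf : MemLp f 2 unif) (hk : MemLp k 2 unif) :
    corrU f k = ⟪ctr f, ctr k⟫_ℝ / (‖ctr f‖ * ‖ctr k‖) := by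
  rw [corrU, inner_ctr hf hk, stdU_eq hf, stdU_eq hk]

lemma integral_sq_eq {f : ℝ → ℝ} (hf : MemLp f 2 unif) :
    ∫ u, f u ^ 2 ∂unif = ‖ctr f‖ ^ 2 + meanU f ^ 2 := by
  rw [← variance_eq_norm_sq hf, variance_eq_sub hf]
  simp [meanU]

/-- Pythagoras for the splitting of `L²` into constants and centred functions. -/
lemma integral_sub_sq_eq {f k : ℝ → ℝ} (hf : MemLp f 2 unif) (hk : MemLp k 2 unif) :
    ∫ u, (f u - k u) ^ 2 ∂unif = ‖ctr f - ctr k‖ ^ 2 + (meanU f - meanU k) ^ 2 := by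
  have e : ∀ u, f u - k u = f u + -1 * k u := fun u => by ring
  simp_rw [e]
  rw [integral_sq_eq (f := fun u => f u + -1 * k u) (hf.add (hk.const_mul (-1))),
    meanU_add hf (hk.const_mul (-1)),
    ctr_add hf (hk.const_mul (-1)), ctr_const_mul hk, meanU_const_mul, neg_one_smul,
    ← sub_eq_add_neg]
  ring

/-! ### The cone of centred isotonic functions -/

/-- The monotone functions in `L²(0, 1)` with mean `0`. -/
def isoCone : Set (Lp ℝ 2 unif) :=
  {x | (∃ k, MonotoneOn k (Ioo 0 1) ∧ x =ᵐ[unif] k) ∧ ∫ u, x u ∂unif = 0}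

lemma ctr_mem_isoCone {k : ℝ → ℝ} (hk : MonotoneOn k (Ioo 0 1)) (h2 : MemLp k 2 unif) :
    ctr k ∈ isoCone := by
  refine ⟨⟨fun u => k u - meanU k, fun u hu v hv huv => sub_le_sub_right (hk hu hv huv) _,
    coeFn_ctr h2⟩, ?_⟩
  rw [integral_congr_ae (coeFn_ctr h2), integral_sub (integrable_of_memLp h2) (integrable_const _)]
  simp [meanU]

lemma exists_isotonic_of_mem_isoCone {x : Lp ℝ 2 unif} (hx : x ∈ isoCone) :
    ∃ k, IsIsotonic k ∧ ctr k = x ∧ meanU k = 0 := by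
  obtain ⟨⟨k, hk, hxk⟩, h0⟩ := hx
  have h2 : MemLp k 2 unif := (Lp.memLp x).ae_eq hxk
  obtain ⟨k', hk', he⟩ := exists_isIsotonic_ae_eq hk h2
  have hxk' : x =ᵐ[unif] k' := hxk.trans he.symm
  have hm : meanU k' = 0 := by rw [← meanU_congr hxk', meanU, h0]
  refine ⟨k', hk', ?_, hm⟩
  refine Lp.ext ?_
  filter_upwards [coeFn_ctr hk'.sq_integrable, hxk'] with u h1 h3
  rw [h1, h3, hm, sub_zero]

lemma exists_mem_of_ae_unif {S : Set ℝ} (hS : ∀ᵐ u ∂unif, u ∈ S) {a b : ℝ} (ha : 0 ≤ a)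
    (hab : a < b) (hb : b ≤ 1) : ∃ v ∈ S, v ∈ Ioo a b := by
  by_contra! hcon
  have h1 : unif (Ioo a b) = 0 := by
    refine measure_mono_null (fun v hv => ?_) (ae_iff.1 hS)
    exact fun hvS => hcon v hvS hv
  rw [unif_apply, inter_eq_left.2 (Ioo_subset_Ioo ha hb), Real.volume_Ioo] at h1
  simp only [ENNReal.ofReal_eq_zero] at h1
  linarith

/-- A function that is monotone on a set of full measure agrees with a monotone function there. -/
lemma exists_monotoneOn_extension {S : Set ℝ} (hS : ∀ᵐ u ∂unif, u ∈ S) {x : ℝ → ℝ}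
    (hx : MonotoneOn x (S ∩ Ioo 0 1)) :
    ∃ k, MonotoneOn k (Ioo 0 1) ∧ EqOn x k (S ∩ Ioo 0 1) := by
  have hbdd : ∀ u ∈ Ioo (0 : ℝ) 1, BddAbove (x '' (S ∩ Ioo 0 1 ∩ Iic u)) := by
    intro u hu
    obtain ⟨v, hvS, hv⟩ := exists_mem_of_ae_unif hS hu.1.le hu.2 le_rfl
    refine ⟨x v, ?_⟩
    rintro _ ⟨w, ⟨hw, hwu⟩, rfl⟩
    exact hx hw ⟨hvS, hu.1.trans hv.1, hv.2⟩ (le_trans hwu hv.1.le)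
  refine ⟨fun u => sSup (x '' (S ∩ Ioo 0 1 ∩ Iic u)), fun u hu v hv huv => ?_, fun u hu => ?_⟩
  · obtain ⟨w, hwS, hw⟩ := exists_mem_of_ae_unif hS le_rfl hu.1 hu.2.le
    refine csSup_le_csSup (hbdd v hv) ?_ (image_mono ?_)
    · exact ⟨x w, w, ⟨⟨hwS, hw.1, hw.2.trans hu.2⟩, hw.2.le⟩, rfl⟩
    · exact inter_subset_inter_right _ (Iic_subset_Iic.2 huv)
  · refine le_antisymm (le_csSup (hbdd u hu.2) ⟨u, ⟨hu, self_mem_Iic⟩, rfl⟩) ?_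
    refine csSup_le ⟨x u, u, ⟨hu, self_mem_Iic⟩, rfl⟩ ?_
    rintro _ ⟨w, ⟨hw, hwu⟩, rfl⟩
    exact hx hw hu hwu

lemma integral_eq_inner_one (x : Lp ℝ 2 unif) :
    ∫ u, x u ∂unif = ⟪(memLp_const (1 : ℝ)).toLp (fun _ : ℝ => (1 : ℝ)), x⟫_ℝ := by
  rw [L2.inner_def]
  refine integral_congr_ae ?_
  filter_upwards [MemLp.coeFn_toLp (memLp_const (1 : ℝ) (p := 2) (μ := unif))] with u hu
  rw [hu]; simp

/-- An `L²` limit is an almost-everywhere limit along a subsequence, hence monotone on a set of full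
measure, from which it extends to a monotone function. -/
lemma isClosed_isoCone : IsClosed isoCone := by
  have h1 : IsClosed {x : Lp ℝ 2 unif | ∃ k, MonotoneOn k (Ioo 0 1) ∧ x =ᵐ[unif] k} := by
    refine isSeqClosed_iff_isClosed.1 fun y x hy hlim => ?_
    obtain ⟨ns, -, hae⟩ := (tendstoInMeasure_of_tendsto_Lp hlim).exists_seq_tendsto_ae
    choose k hk hyk using hy
    have hS : ∀ᵐ u ∂unif, u ∈ {u | Tendsto (fun i => k (ns i) u) atTop (𝓝 (x u))} := by
      filter_upwards [hae, ae_all_iff.2 fun i => hyk (ns i)] with u hu hu'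
      exact hu.congr hu'
    obtain ⟨k', hk', he⟩ := exists_monotoneOn_extension hS (x := x) (fun u hu v hv huv =>
      le_of_tendsto_of_tendsto' hu.1 hv.1 fun i => hk (ns i) hu.2 hv.2 huv)
    refine ⟨k', hk', ?_⟩
    filter_upwards [hS, ae_unif_mem] with u hu hu'
    exact he ⟨hu, hu'⟩
  have h2 : IsClosed {x : Lp ℝ 2 unif | ∫ u, x u ∂unif = 0} := by
    simp_rw [integral_eq_inner_one]
    exact isClosed_eq (continuous_const.inner continuous_id) continuous_const
  exact h1.inter h2

lemma isClosedConvexCone_isoCone : IsClosedConvexCone isoCone where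
  zero_mem := by
    rw [← ctr_const 0]
    exact ctr_mem_isoCone (fun _ _ _ _ _ => le_rfl) (memLp_const 0)
  add_mem := by
    intro x hx y hy
    obtain ⟨k, hk, rfl, -⟩ := exists_isotonic_of_mem_isoCone hx
    obtain ⟨l, hl, rfl, -⟩ := exists_isotonic_of_mem_isoCone hy
    rw [← ctr_add hk.sq_integrable hl.sq_integrable]
    exact ctr_mem_isoCone (fun u hu v hv huv => add_le_add (hk.mono hu hv huv)
      (hl.mono hu hv huv)) (hk.sq_integrable.add hl.sq_integrable)
  smul_mem := by
    intro a ha x hx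
    obtain ⟨k, hk, rfl, -⟩ := exists_isotonic_of_mem_isoCone hx
    rw [← ctr_const_mul hk.sq_integrable]
    exact ctr_mem_isoCone (fun u hu v hv huv => mul_le_mul_of_nonneg_left (hk.mono hu hv huv) ha)
      (hk.sq_integrable.const_mul a)
  closed := isClosed_isoCone

lemma IsIsotonic.ctr_mem {k : ℝ → ℝ} (hk : IsIsotonic k) : ctr k ∈ isoCone :=
  ctr_mem_isoCone hk.mono hk.sq_integrable

lemma IsIsotonic.add_const {k : ℝ → ℝ} (hk : IsIsotonic k) (c : ℝ) :
    IsIsotonic (fun u => k u + c) :=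
  ⟨hk.sq_integrable.add (memLp_const c), fun _ hu _ hv huv => add_le_add_left (hk.mono hu hv huv) c,
    fun u hu => (hk.left_cont u hu).add continuousWithinAt_const⟩

lemma IsIsotonic.const_mul {k : ℝ → ℝ} (hk : IsIsotonic k) {c : ℝ} (hc : 0 ≤ c) :
    IsIsotonic (fun u => c * k u) :=
  ⟨hk.sq_integrable.const_mul c,
    fun _ hu _ hv huv => mul_le_mul_of_nonneg_left (hk.mono hu hv huv) hc,
    fun u hu => continuousWithinAt_const.mul (hk.left_cont u hu)⟩

lemma isIsotonic_const (c : ℝ) : IsIsotonic (fun _ => c) :=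
  ⟨memLp_const c, fun _ _ _ _ _ => le_rfl, fun _ _ => continuousWithinAt_const⟩

lemma IsIsotonic.eqOn_of_ctr_eq {k l : ℝ → ℝ} (hk : IsIsotonic k) (hl : IsIsotonic l)
    (hc : ctr k = ctr l) (hm : meanU k = meanU l) : EqOn k l (Ioo 0 1) := by
  refine hk.eqOn_of_ae_eq hl ?_
  have := (ctr_eq_iff hk.sq_integrable hl.sq_integrable).1 hc
  simpa [hm] using this

lemma IsIsotonic.isConstant_iff {k : ℝ → ℝ} (hk : IsIsotonic k) : IsConstant k ↔ ctr k = 0 := by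
  constructor
  · rintro ⟨c, hc⟩
    rw [← ctr_const c]
    exact ctr_congr (ae_unif_mem.mono hc)
  · intro h
    exact ⟨meanU k, hk.eqOn_of_ctr_eq (isIsotonic_const _) (by rw [h, ctr_const])
      (meanU_const _).symm⟩

/-! ### The isotonic projection -/

/-- Isotonic functions may be shifted by constants, so the two terms of Pythagoras are minimised
separately: the mean is matched exactly, and the centred part is a projection on the cone. -/
lemma isIsotonicProjection_iff {f k : ℝ → ℝ} (hf : MemLp f 2 unif) :
    IsIsotonicProjection f k ↔
      IsIsotonic k ∧ meanU k = meanU f ∧ IsConeProj isoCone (ctr f) (ctr k) := by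
  constructor
  · rintro ⟨hk, hmin⟩
    have hmin' : ∀ w, IsIsotonic w → ‖ctr f - ctr k‖ ^ 2 + (meanU f - meanU k) ^ 2 ≤
        ‖ctr f - ctr w‖ ^ 2 := by
      intro w hw
      have := hmin _ (hw.add_const (meanU f - meanU w))
      rw [integral_sub_sq_eq hf hk.sq_integrable,
        integral_sub_sq_eq hf (hw.add_const _).sq_integrable, ctr_add_const hw.sq_integrable,
        meanU_add_const hw.sq_integrable] at this
      simpa using this
    refine ⟨hk, ?_, .of_forall_norm_le isClosedConvexCone_isoCone hk.ctr_mem fun w hw => ?_⟩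
    · have h0 : (meanU f - meanU k) ^ 2 ≤ 0 := by linarith [hmin' k hk]
      have := pow_eq_zero_iff (two_ne_zero) |>.1 (le_antisymm h0 (sq_nonneg _))
      linarith
    · obtain ⟨k', hk', rfl, -⟩ := exists_isotonic_of_mem_isoCone hw
      have := hmin' k' hk'
      exact le_of_sq_le_sq (by nlinarith [sq_nonneg (meanU f - meanU k)]) (norm_nonneg _)
  · rintro ⟨hk, hm, hp⟩
    refine ⟨hk, fun w hw => ?_⟩
    rw [integral_sub_sq_eq hf hk.sq_integrable, integral_sub_sq_eq hf hw.sq_integrable, hm]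
    have := hp.norm_sub_sq_le hw.ctr_mem
    nlinarith [sq_nonneg (meanU f - meanU w)]

lemma exists_isIsotonicProjection {f : ℝ → ℝ} (hf : MemLp f 2 unif) :
    ∃ k, IsIsotonicProjection f k := by
  obtain ⟨v, hv⟩ := exists_isConeProj isClosedConvexCone_isoCone (ctr f)
  obtain ⟨k, hk, rfl, hm⟩ := exists_isotonic_of_mem_isoCone hv.mem
  refine ⟨_, (isIsotonicProjection_iff hf).2 ⟨hk.add_const (meanU f), ?_, ?_⟩⟩
  · rw [meanU_add_const hk.sq_integrable, hm, zero_add]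
  · rwa [ctr_add_const hk.sq_integrable]

lemma isIsotonicProjection_isotonicProjection {f : ℝ → ℝ} (hf : MemLp f 2 unif) :
    IsIsotonicProjection f (isotonicProjection f) :=
  Classical.epsilon_spec (exists_isIsotonicProjection hf)

lemma IsIsotonicProjection.eqOn {f k l : ℝ → ℝ} (hf : MemLp f 2 unif)
    (hk : IsIsotonicProjection f k) (hl : IsIsotonicProjection f l) : EqOn k l (Ioo 0 1) := by
  obtain ⟨h1, h2, h3⟩ := (isIsotonicProjection_iff hf).1 hk
  obtain ⟨h1', h2', h3'⟩ := (isIsotonicProjection_iff hf).1 hl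
  exact h1.eqOn_of_ctr_eq h1' (h3.unique h3') (h2.trans h2'.symm)

/-! ### Polar elements orthogonal to an isotonic function -/

lemma integral_ctr (f : ℝ → ℝ) : ∫ u, ctr f u ∂unif = 0 := by
  by_cases hf : MemLp f 2 unif
  · rw [integral_congr_ae (coeFn_ctr hf),
      integral_sub (integrable_of_memLp hf) (integrable_const _)]
    simp [meanU]
  · rw [ctr, dif_neg hf, integral_congr_ae (Lp.coeFn_zero ℝ 2 unif)]
    simp

lemma inner_ctr_right {x : Lp ℝ 2 unif} (hx : ∫ u, x u ∂unif = 0) {k : ℝ → ℝ}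
    (hk : MemLp k 2 unif) : ⟪x, ctr k⟫_ℝ = ∫ u, x u * k u ∂unif := by
  rw [L2.inner_def]
  have h1 : ∫ u, ⟪x u, ctr k u⟫_ℝ ∂unif = ∫ u, (x u * k u - meanU k * x u) ∂unif := by
    refine integral_congr_ae ?_
    filter_upwards [coeFn_ctr hk] with u hu
    rw [hu]
    simp only [RCLike.inner_apply, conj_trivial]
    ring
  have hxk : Integrable (fun u => x u * k u) unif := (Lp.memLp x).integrable_mul hk
  rw [h1, integral_sub hxk ((integrable_of_memLp (Lp.memLp x)).const_mul _), integral_const_mul, hx,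
    mul_zero, sub_zero]

lemma memLp_of_bounded {k : ℝ → ℝ} (hm : AEMeasurable k unif) {c : ℝ} (hb : ∀ u, |k u| ≤ c) :
    MemLp k 2 unif :=
  MemLp.of_bound hm.aestronglyMeasurable c (Eventually.of_forall hb)

/-- Both `t ∘ v` and `K v - t ∘ v` are monotone, so both pairings with `x` are non-positive; their
sum is `K ⟪x, v⟫ = 0`. -/
lemma inner_ctr_lipschitz_comp_eq_zero {x : Lp ℝ 2 unif} (hx : ∀ w ∈ isoCone, ⟪x, w⟫_ℝ ≤ 0)
    {v : ℝ → ℝ} (hv : MonotoneOn v (Ioo 0 1)) (hv2 : MemLp v 2 unif) (hxv : ⟪x, ctr v⟫_ℝ = 0)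
    {t : ℝ → ℝ} {K : ℝ} (ht : Monotone t) (hK : ∀ a b, a ≤ b → t b - t a ≤ K * (b - a))
    (ht2 : MemLp (fun u => t (v u)) 2 unif) : ⟪x, ctr (fun u => t (v u))⟫_ℝ = 0 := by
  have h1 := hx _ (ctr_mem_isoCone (fun u hu w hw huw => ht (hv hu hw huw)) ht2)
  have hmono : MonotoneOn (fun u => K * v u + -1 * t (v u)) (Ioo 0 1) := by
    intro u hu w hw huw
    have := hK _ _ (hv hu hw huw)
    change K * v u + -1 * t (v u) ≤ K * v w + -1 * t (v w)
    linarith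
  have h2 := hx _ (ctr_mem_isoCone hmono ((hv2.const_mul K).add (ht2.const_mul (-1))))
  rw [ctr_add (hv2.const_mul K) (ht2.const_mul (-1)), ctr_const_mul hv2, ctr_const_mul ht2,
    inner_add_right, inner_smul_right, inner_smul_right, hxv] at h2
  linarith

/-- The ramp function used to approximate indicators of half-lines. -/
noncomputable def ramp (n : ℕ) (x : ℝ) : ℝ := min 1 (max 0 (n * x))

lemma monotone_ramp (n : ℕ) : Monotone (ramp n) := fun a b hab => by
  unfold ramp
  gcongr

lemma ramp_nonneg (n : ℕ) (x : ℝ) : 0 ≤ ramp n x := le_min zero_le_one (le_max_left _ _)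

lemma ramp_le_one (n : ℕ) (x : ℝ) : ramp n x ≤ 1 := min_le_left _ _

lemma abs_ramp_le (n : ℕ) (x : ℝ) : |ramp n x| ≤ 1 := by
  rw [abs_of_nonneg (ramp_nonneg n x)]
  exact ramp_le_one n x

lemma ramp_sub_le (n : ℕ) {a b : ℝ} (hab : a ≤ b) : ramp n b - ramp n a ≤ n * (b - a) := by
  have h0 : (n : ℝ) * a ≤ n * b := by gcongr
  unfold ramp
  rw [mul_sub]
  rcases max_cases 0 ((n : ℝ) * a) with h1 | h1 <;> rcases max_cases 0 ((n : ℝ) * b) with h2 | h2 <;>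
  rcases min_cases 1 (max 0 ((n : ℝ) * a)) with h3 | h3 <;>
  rcases min_cases 1 (max 0 ((n : ℝ) * b)) with h4 | h4 <;> linarith

lemma ramp_of_nonpos (n : ℕ) {x : ℝ} (hx : x ≤ 0) : ramp n x = 0 := by
  have : (n : ℝ) * x ≤ 0 := mul_nonpos_of_nonneg_of_nonpos n.cast_nonneg hx
  simp [ramp, max_eq_left this]

lemma eventually_ramp_eq_one {x : ℝ} (hx : 0 < x) : ∀ᶠ n : ℕ in atTop, ramp n x = 1 := by
  obtain ⟨N, hN⟩ := exists_nat_gt (1 / x)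
  filter_upwards [eventually_ge_atTop N] with n hn
  have h1 : 1 / x ≤ (n : ℝ) := hN.le.trans (by exact_mod_cast hn)
  rw [div_le_iff₀ hx] at h1
  exact min_eq_left (h1.trans (le_max_right _ _))

lemma tendsto_ramp (x : ℝ) :
    Tendsto (fun n => ramp n x) atTop (𝓝 ((Ioi (0 : ℝ)).indicator 1 x)) := by
  rcases le_or_gt x 0 with h | h
  · simp [ramp_of_nonpos _ h, not_lt.2 h]
  · rw [indicator_of_mem (mem_Ioi.2 h)]
    exact tendsto_const_nhds.congr' ((eventually_ramp_eq_one h).mono fun n hn => hn.symm)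

/-- The shift by `1 / n` moves the rising part of the ramp to the left of `0`, so that the limit
includes the endpoint. Both kinds of half-line are needed to isolate a level set. -/
lemma tendsto_ramp_add (x : ℝ) :
    Tendsto (fun n : ℕ => ramp n (x + 1 / n)) atTop (𝓝 ((Ici (0 : ℝ)).indicator 1 x)) := by
  rcases lt_or_ge x 0 with h | h
  · rw [indicator_of_notMem (by simpa using h)]
    refine tendsto_const_nhds.congr' ?_
    have ht : Tendsto (fun n : ℕ => x + 1 / (n : ℝ)) atTop (𝓝 (x + 0)) :=
      tendsto_const_nhds.add tendsto_one_div_atTop_nhds_zero_nat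
    rw [add_zero] at ht
    filter_upwards [ht.eventually (gt_mem_nhds h)] with n hn
    exact (ramp_of_nonpos n hn.le).symm
  · rw [indicator_of_mem (mem_Ici.2 h)]
    refine tendsto_const_nhds.congr' ?_
    filter_upwards [eventually_gt_atTop 0] with n hn
    have hn' : (0 : ℝ) < n := by exact_mod_cast hn
    refine (min_eq_left (le_max_of_le_right ?_)).symm
    rw [mul_add, mul_one_div_cancel hn'.ne']
    have := mul_nonneg hn'.le h
    rw [Pi.one_apply]
    linarith

/-- `x` is orthogonal to the indicators of all level sets of `v`. -/
structure IsLevelOrthogonal (x v : ℝ → ℝ) : Prop where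
  gt : ∀ s, ∫ u, x u * (Ioi s).indicator 1 (v u) ∂unif = 0
  ge : ∀ s, ∫ u, x u * (Ici s).indicator 1 (v u) ∂unif = 0

lemma isLevelOrthogonal_of_lipschitz {x : Lp ℝ 2 unif} (hx : ∫ u, x u ∂unif = 0) {v : ℝ → ℝ}
    (hv : AEMeasurable v unif)
    (h : ∀ (t : ℝ → ℝ) (K : ℝ), Monotone t → (∀ a b, a ≤ b → t b - t a ≤ K * (b - a)) →
      MemLp (fun u => t (v u)) 2 unif → ⟪x, ctr (fun u => t (v u))⟫_ℝ = 0) :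
    IsLevelOrthogonal x v := by
  have hlim : ∀ (c : ℕ → ℝ) (T : ℝ → ℝ),
      (∀ y, Tendsto (fun n => ramp n (y + c n)) atTop (𝓝 (T y))) →
      ∫ u, x u * T (v u) ∂unif = 0 := by
    intro c T hT
    have hmeas : ∀ n, AEMeasurable (fun u => ramp n (v u + c n)) unif := fun n =>
      (monotone_ramp n).measurable.comp_aemeasurable (hv.add_const _)
    have hmem : ∀ n, MemLp (fun u => ramp n (v u + c n)) 2 unif := fun n =>
      memLp_of_bounded (hmeas n) fun u => abs_ramp_le n _
    have h0 : ∀ n, ∫ u, x u * ramp n (v u + c n) ∂unif = 0 := by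
      intro n
      rw [← inner_ctr_right hx (hmem n)]
      refine h (fun y => ramp n (y + c n)) n
        (fun a b hab => monotone_ramp n (by linarith)) (fun a b hab => ?_) (hmem n)
      have := ramp_sub_le n (add_le_add_left hab (c n))
      rwa [add_sub_add_right_eq_sub] at this
    have ht := tendsto_integral_of_dominated_convergence (μ := unif)
      (F := fun n u => x u * ramp n (v u + c n)) (f := fun u => x u * T (v u)) (fun u => ‖x u‖)
      (fun n => (Lp.aestronglyMeasurable x).mul (hmeas n).aestronglyMeasurable)
      (integrable_of_memLp (Lp.memLp x)).norm
      (fun n => Eventually.of_forall fun u => by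
        rw [norm_mul]
        exact mul_le_of_le_one_right (norm_nonneg _) (abs_ramp_le _ _))
      (Eventually.of_forall fun u => (hT (v u)).const_mul (x u))
    simp_rw [h0] at ht
    exact tendsto_nhds_unique ht tendsto_const_nhds
  refine ⟨fun s => ?_, fun s => ?_⟩
  · refine hlim (fun _ => -s) _ fun y => ?_
    convert tendsto_ramp (y + -s) using 2
    simp only [indicator, mem_Ioi]
    congr 1
    rw [eq_iff_iff]; constructor <;> intro _ <;> linarith
  · refine hlim (fun n => -s + 1 / n) _ fun y => ?_
    convert tendsto_ramp_add (y + -s) using 2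
    · rw [add_assoc]
    · simp only [indicator, mem_Ici]
      congr 1
      rw [eq_iff_iff]; constructor <;> intro _ <;> linarith

lemma integrable_mul_indicator {x v : ℝ → ℝ} (hx : Integrable x unif) (hv : AEMeasurable v unif)
    {S : Set ℝ} (hS : MeasurableSet S) :
    Integrable (fun u => x u * S.indicator 1 (v u)) unif := by
  refine hx.mul_bdd (c := 1) ?_ (Eventually.of_forall fun u => ?_)
  · exact ((measurable_one.indicator hS).comp_aemeasurable hv).aestronglyMeasurable
  · by_cases h : v u ∈ S <;> simp [h]

/-- If `x = φ - C v - c` with `φ`, `v` monotone, and `x` integrates to zero over the level sets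
of `v`, then the integrals of `x` over `(a, 1)` are non-negative: on each level set of `v`
there is a single sign change. -/
lemma integral_Ioi_nonneg_of_levelOrthogonal {x v φ : ℝ → ℝ} (hx : Integrable x unif)
    (hv : MonotoneOn v (Ioo 0 1)) (hφ : MonotoneOn φ (Ioo 0 1)) {C c : ℝ}
    (hxe : ∀ᵐ u ∂unif, x u = φ u - C * v u - c) (hxv : IsLevelOrthogonal x v) {a : ℝ}
    (ha : a ∈ Ioo (0 : ℝ) 1) : 0 ≤ ∫ u, x u * (Ioi a).indicator 1 u ∂unif := by
  have hvm := aemeasurable_of_monotoneOn hv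
  set s := v a with hs
  set d := C * s + c with hd
  have i1 := integrable_mul_indicator hx hvm (measurableSet_Ioi (a := s))
  have i2 := integrable_mul_indicator hx hvm (measurableSet_Ici (a := s))
  have i3 := integrable_mul_indicator hx aemeasurable_id' (measurableSet_Ioi (a := a))
  -- On the level set `{v = s}` one has `x = φ - d`. If `φ a ≥ d`, the part of it to the right of
  -- `a` contributes non-negatively and `(a, 1)` is compared with `{v > s}`; otherwise the part to
  -- the left contributes non-positively and the comparison is with `{v ≥ s}`.
  rcases le_or_gt d (φ a) with hcase | hcase
  · rw [← hxv.gt s]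
    refine integral_mono_ae i1 i3 ?_
    filter_upwards [hxe, ae_unif_mem] with u hu hmem
    by_cases h1 : s < v u
    · have h2 : a < u := by
        by_contra! hle
        exact absurd (hv hmem ha hle) (not_le.2 h1)
      simp [h1, h2]
    · by_cases h2 : a < u
      · have h3 : v u = s := le_antisymm (not_lt.1 h1) (hv ha hmem h2.le)
        have h4 := hφ ha hmem h2.le
        simp only [h3, mem_Ioi, lt_self_iff_false, not_false_eq_true, indicator_of_notMem, mul_zero,
          h2, indicator_of_mem, Pi.one_apply, mul_one]
        rw [hu, h3]; linarith
      · simp [h1, h2]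
  · rw [← hxv.ge s]
    refine integral_mono_ae i2 i3 ?_
    filter_upwards [hxe, ae_unif_mem] with u hu hmem
    by_cases h2 : a < u
    · have h1 : s ≤ v u := hv ha hmem h2.le
      simp [h1, h2]
    · by_cases h1 : s ≤ v u
      · have h3 : v u = s := le_antisymm (hv hmem ha (not_lt.1 h2)) h1
        have h4 := hφ hmem ha (not_lt.1 h2)
        simp only [h3, mem_Ici, le_refl, indicator_of_mem, Pi.one_apply, mul_one, mem_Ioi, h2,
          not_false_eq_true, indicator_of_notMem, mul_zero]
        rw [hu, h3]; linarith
      · simp [h1, h2]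

/-- Non-negative integrals over the intervals `(a, 1)` give non-negative integrals over all
superlevel sets of monotone functions. -/
lemma integral_superlevel_nonneg {x : ℝ → ℝ} (h0 : ∫ u, x u ∂unif = 0)
    (hx : ∀ a ∈ Ioo (0 : ℝ) 1, 0 ≤ ∫ u, x u * (Ioi a).indicator 1 u ∂unif) {p : ℝ → ℝ}
    (hp : MonotoneOn p (Ioo 0 1)) (s : ℝ) :
    0 ≤ ∫ u, x u * (Ioi s).indicator 1 (p u) ∂unif := by
  set S := {u | u ∈ Ioo (0 : ℝ) 1 ∧ s < p u} with hS
  have hbdd : BddBelow S := ⟨0, fun u hu => hu.1.1.le⟩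
  rcases S.eq_empty_or_nonempty with he | hne
  · refine le_of_eq (Eq.symm ?_)
    rw [integral_eq_zero_of_ae]
    filter_upwards [ae_unif_mem] with u hu
    have : ¬ s < p u := fun h => by
      have : u ∈ S := ⟨hu, h⟩
      rw [he] at this
      exact this
    simp [this]
  · have hup : ∀ u ∈ Ioo (0 : ℝ) 1, sInf S < u → s < p u := by
      intro u hu hlt
      obtain ⟨w, hw, hwu⟩ := exists_lt_of_csInf_lt hne hlt
      exact lt_of_lt_of_le hw.2 (hp hw.1 hu hwu.le)
    obtain ⟨w, hw⟩ := hne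
    have h1 : sInf S < 1 := lt_of_le_of_lt (csInf_le hbdd hw) hw.1.2
    have hnn : 0 ≤ sInf S := le_csInf ⟨w, hw⟩ fun u hu => hu.1.1.le
    rcases hnn.eq_or_lt with hz | hpos
    · refine le_of_eq ?_
      rw [← h0]
      refine integral_congr_ae ?_
      filter_upwards [ae_unif_mem] with u hu
      have : s < p u := hup u hu (hz ▸ hu.1)
      simp [this]
    · refine (hx _ ⟨hpos, h1⟩).trans_eq (integral_congr_ae ?_)
      have hnull : NullSingletonClass unif := by unfold unif; infer_instance
      filter_upwards [ae_unif_mem,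
        measure_eq_zero_iff_ae_notMem.1 (measure_singleton (μ := unif) (sInf S))] with u hu hne'
      rcases lt_or_gt_of_ne hne' with hlt | hgt
      · have : ¬ s < p u := fun h => absurd (csInf_le hbdd (⟨hu, h⟩ : u ∈ S)) (not_le.2 hlt)
        simp [this, hlt.le]
      · have := hup u hu hgt
        simp [this, hgt]

/-- It suffices that the projection `p` of `-x` on the cone vanishes. The residual `-x - p` is
orthogonal to the indicator of `{p > 0}`, so the integrals of `x` and of `p` over this set add up to
zero. Both are non-negative, hence `p ≤ 0` almost everywhere, and `p` has mean `0`. -/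
lemma inner_nonneg_of_integral_Ioi_nonneg {x : Lp ℝ 2 unif} (h0 : ∫ u, x u ∂unif = 0)
    (hx : ∀ a ∈ Ioo (0 : ℝ) 1, 0 ≤ ∫ u, x u * (Ioi a).indicator 1 u ∂unif)
    {w : Lp ℝ 2 unif} (hw : w ∈ isoCone) : 0 ≤ ⟪x, w⟫_ℝ := by
  obtain ⟨q, hq⟩ := exists_isConeProj isClosedConvexCone_isoCone (-x)
  obtain ⟨p, hp, rfl, hpm⟩ := exists_isotonic_of_mem_isoCone hq.mem
  have hpi := integrable_of_memLp hp.sq_integrable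
  have hcoe : ∀ᵐ u ∂unif, (-x - ctr p : Lp ℝ 2 unif) u = -x u - p u := by
    filter_upwards [Lp.coeFn_sub (-x) (ctr p), Lp.coeFn_neg x, coeFn_ctr hp.sq_integrable]
      with u h1 h2 h3
    rw [h1, Pi.sub_apply, h2, h3, hpm, sub_zero, Pi.neg_apply]
  have hy0 : ∫ u, (-x - ctr p : Lp ℝ 2 unif) u ∂unif = 0 := by
    have hxi : Integrable (fun u => -x u) unif := (integrable_of_memLp (Lp.memLp x)).neg
    rw [integral_congr_ae hcoe, integral_sub hxi hpi, integral_neg, h0]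
    change -0 - meanU p = 0
    rw [hpm]; simp
  have hlev := (isLevelOrthogonal_of_lipschitz hy0 hp.sq_integrable.aestronglyMeasurable.aemeasurable
    fun t K ht hK ht2 => inner_ctr_lipschitz_comp_eq_zero hq.inner_nonpos hp.mono
      hp.sq_integrable hq.inner_self ht hK ht2).gt 0
  have hpmeas := hp.sq_integrable.aestronglyMeasurable.aemeasurable
  have j1 := integrable_mul_indicator (integrable_of_memLp (Lp.memLp x)) hpmeas
    (measurableSet_Ioi (a := (0 : ℝ)))
  have j2 := integrable_mul_indicator hpi hpmeas (measurableSet_Ioi (a := (0 : ℝ)))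
  have hsplit : ∫ u, x u * (Ioi (0 : ℝ)).indicator 1 (p u) ∂unif +
      ∫ u, p u * (Ioi (0 : ℝ)).indicator 1 (p u) ∂unif = 0 := by
    rw [← integral_add j1 j2, ← neg_eq_zero, ← integral_neg]
    refine Eq.trans (integral_congr_ae ?_) hlev
    filter_upwards [hcoe] with u hu
    rw [hu]; ring
  have hxp := integral_superlevel_nonneg h0 hx hp.mono 0
  have hpos : ∀ u, 0 ≤ p u * (Ioi (0 : ℝ)).indicator 1 (p u) := by
    intro u
    by_cases h : 0 < p u
    · simp [h, h.le]
    · simp [h]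
  have hz : ∫ u, p u * (Ioi (0 : ℝ)).indicator 1 (p u) ∂unif = 0 :=
    le_antisymm (by linarith) (integral_nonneg hpos)
  rw [integral_eq_zero_iff_of_nonneg hpos j2] at hz
  have hple : ∀ᵐ u ∂unif, 0 ≤ -p u := by
    filter_upwards [hz] with u hu
    by_contra! hlt
    have h' : 0 < p u := by linarith
    simp [h', h'.ne'] at hu
  have hpz : ∫ u, -p u ∂unif = 0 := by
    rw [integral_neg]
    change -meanU p = 0
    rw [hpm, neg_zero]
  rw [integral_eq_zero_iff_of_nonneg_ae hple hpi.neg] at hpz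
  have hp0 : ctr p = 0 := by
    rw [← ctr_const 0]
    refine ctr_congr ?_
    filter_upwards [hpz] with u hu
    simpa using hu
  have := hq.inner_nonpos w hw
  rw [hp0, sub_zero, inner_neg_left] at this
  linarith

/-- The criterion for `x` to pair non-negatively with all isotonic functions. -/
lemma inner_nonneg_of_levelOrthogonal {φ v : ℝ → ℝ} (hφ : IsIsotonic φ) (hv : IsIsotonic v)
    {C : ℝ} (hlev : IsLevelOrthogonal (ctr φ - C • ctr v : Lp ℝ 2 unif) v)
    {w : Lp ℝ 2 unif} (hw : w ∈ isoCone) : 0 ≤ ⟪ctr φ - C • ctr v, w⟫_ℝ := by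
  set x : Lp ℝ 2 unif := ctr φ - C • ctr v with hx
  have hcoe : ∀ᵐ u ∂unif, x u = φ u - C * v u - (meanU φ - C * meanU v) := by
    filter_upwards [Lp.coeFn_sub (ctr φ) (C • ctr v), Lp.coeFn_smul C (ctr v),
      coeFn_ctr hφ.sq_integrable, coeFn_ctr hv.sq_integrable] with u h1 h2 h3 h4
    rw [h1, Pi.sub_apply, h2, Pi.smul_apply, h3, h4, smul_eq_mul]
    ring
  have h0 : ∫ u, x u ∂unif = 0 := by
    rw [integral_eq_inner_one, hx, inner_sub_right, inner_smul_right, ← integral_eq_inner_one,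
      ← integral_eq_inner_one, integral_ctr, integral_ctr]
    simp
  exact inner_nonneg_of_integral_Ioi_nonneg h0 (fun a ha =>
    integral_Ioi_nonneg_of_levelOrthogonal (integrable_of_memLp (Lp.memLp x)) hv.mono hφ.mono hcoe
      hlev ha) hw

/-- Chebyshev's inequality: monotone functions are non-negatively correlated. -/
lemma inner_nonneg_of_mem_isoCone {x y : Lp ℝ 2 unif} (hx : x ∈ isoCone) (hy : y ∈ isoCone) :
    0 ≤ ⟪x, y⟫_ℝ := by
  obtain ⟨φ, hφ, rfl, -⟩ := exists_isotonic_of_mem_isoCone hx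
  -- For constant `v` every level set is empty or everything, so level orthogonality only asks that
  -- `x` integrates to zero.
  have h := inner_nonneg_of_levelOrthogonal (C := 0) hφ (isIsotonic_const 0) ?_ hy
  · simpa using h
  · rw [zero_smul, sub_zero]
    refine ⟨fun s => ?_, fun s => ?_⟩ <;> rw [integral_mul_const, integral_ctr, zero_mul]

/-- If the projections of two points that differ by a multiple of an isotonic `φ` lie on the same
ray `ℝ₊ v`, then `φ - C v` pairs non-negatively with all isotonic functions. -/
lemma inner_nonneg_of_isConeProj_smul {z₁ z₂ φ v : Lp ℝ 2 unif} (hφ : φ ∈ isoCone)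
    (hv : v ∈ isoCone) {a₁ a₂ δ : ℝ} (ha₁ : 0 < a₁) (ha₂ : 0 < a₂) (hδ : 0 < δ)
    (h₁ : IsConeProj isoCone z₁ (a₁ • v)) (h₂ : IsConeProj isoCone z₂ (a₂ • v))
    (hz : z₂ - z₁ = δ • φ) {w : Lp ℝ 2 unif} (hw : w ∈ isoCone) :
    0 ≤ ⟪φ - ((a₂ - a₁) / δ) • v, w⟫_ℝ := by
  obtain ⟨f, hf, rfl, -⟩ := exists_isotonic_of_mem_isoCone hφ
  obtain ⟨k, hk, rfl, -⟩ := exists_isotonic_of_mem_isoCone hv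
  refine inner_nonneg_of_levelOrthogonal hf hk ?_ hw
  -- Up to the factor `δ⁻¹` the vector is a difference of two projection residuals. Each is polar to
  -- the cone and orthogonal to `k`, hence orthogonal to the level sets of `k`.
  have hx : ctr f - ((a₂ - a₁) / δ) • ctr k =
      δ⁻¹ • ((z₂ - a₂ • ctr k) - (z₁ - a₁ • ctr k)) := by
    have e : (z₂ - a₂ • ctr k) - (z₁ - a₁ • ctr k) = (z₂ - z₁) - (a₂ - a₁) • ctr k := by
      rw [sub_smul]; abel
    rw [e, hz, smul_sub, smul_smul, smul_smul, inv_mul_cancel₀ hδ.ne', one_smul, div_eq_inv_mul]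
  have hperp : ∀ {z : Lp ℝ 2 unif} {a : ℝ}, 0 < a → IsConeProj isoCone z (a • ctr k) →
      ⟪z - a • ctr k, ctr k⟫_ℝ = 0 := by
    intro z a ha h
    have := h.inner_self
    rw [inner_smul_right] at this
    exact (mul_eq_zero.1 this).resolve_left ha.ne'
  refine isLevelOrthogonal_of_lipschitz ?_ hk.sq_integrable.aestronglyMeasurable.aemeasurable ?_
  · rw [integral_eq_inner_one, inner_sub_right, inner_smul_right, ← integral_eq_inner_one,
      ← integral_eq_inner_one, integral_ctr, integral_ctr]
    simp
  · intro t K ht hK ht2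
    rw [hx, inner_smul_left, inner_sub_left,
      inner_ctr_lipschitz_comp_eq_zero h₁.inner_nonpos hk.mono hk.sq_integrable (hperp ha₁ h₁)
        ht hK ht2,
      inner_ctr_lipschitz_comp_eq_zero h₂.inner_nonpos hk.mono hk.sq_integrable (hperp ha₂ h₂)
        ht hK ht2]
    simp

/-! ### Projections of the half-line `γ + l φ`, `l ≥ 0` -/

section Tilted

variable {H : Type*} [NormedAddCommGroup H] [InnerProductSpace ℝ H]

/-- `k l` is the projection of `γ + l φ` on a cone `C` containing `φ`, and it vanishes for no
`l > 0`. If two of these projections lie on the same ray `ℝ₊ v`, then `φ - c v`, with `c` the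
slope of the norm, pairs non-negatively with `C`. -/
structure IsTiltedFamily (C : Set H) (γ φ : H) (k : ℝ → H) : Prop where
  mem : φ ∈ C
  ne_zero : φ ≠ 0
  proj : ∀ l, 0 ≤ l → IsConeProj C (γ + l • φ) (k l)
  proj_ne_zero : ∀ l, 0 < l → k l ≠ 0
  inner_nonneg : ∀ w ∈ C, 0 ≤ ⟪φ, w⟫_ℝ
  flat : ∀ v ∈ C, ∀ a₁ a₂ l₁ l₂ : ℝ, 0 < a₁ → 0 < a₂ → 0 < l₁ → l₁ < l₂ → k l₁ = a₁ • v →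
    k l₂ = a₂ • v → ∀ w ∈ C, 0 ≤ ⟪φ - ((a₂ - a₁) / (l₂ - l₁)) • v, w⟫_ℝ

/-- The cosine of the angle between two vectors. -/
noncomputable def cosine (x y : H) : ℝ := ⟪x, y⟫_ℝ / (‖x‖ * ‖y‖)

lemma cosine_smul_right (x y : H) {a : ℝ} (ha : 0 < a) : cosine x (a • y) = cosine x y := by
  rw [cosine, cosine, inner_smul_right, norm_smul, Real.norm_of_nonneg ha.le,
    mul_left_comm, mul_div_mul_left _ _ ha.ne']

lemma continuousAt_cosine {x y : H} (hx : x ≠ 0) (hy : y ≠ 0) : ContinuousAt (cosine x) y := by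
  unfold cosine
  refine ContinuousAt.div (by fun_prop) (by fun_prop) ?_
  exact mul_ne_zero (norm_ne_zero_iff.2 hx) (norm_ne_zero_iff.2 hy)

lemma cosine_self {x : H} (hx : x ≠ 0) : cosine x x = 1 := by
  rw [cosine, real_inner_self_eq_norm_mul_norm, div_self]
  exact mul_ne_zero (norm_ne_zero_iff.2 hx) (norm_ne_zero_iff.2 hx)

lemma IsConeProj.inner_le_norm_mul {C : Set H} {z v w : H} (h : IsConeProj C z v) (hw : w ∈ C) :
    ⟪z, w⟫_ℝ ≤ ‖v‖ * ‖w‖ := (h.inner_le hw).trans (real_inner_le_norm _ _)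

lemma IsConeProj.eq_smul_of_norm_mul_le {C : Set H} {z v w : H} (h : IsConeProj C z v)
    (hw : w ∈ C) (hv : v ≠ 0) (hle : ‖v‖ * ‖w‖ ≤ ⟪z, w⟫_ℝ) : w = (‖w‖ / ‖v‖) • v := by
  have heq : ⟪v, w⟫_ℝ = ‖v‖ * ‖w‖ :=
    le_antisymm (real_inner_le_norm _ _) (hle.trans (h.inner_le hw))
  rw [inner_eq_norm_mul_iff_real] at heq
  have hv' := norm_ne_zero_iff.2 hv
  rw [div_eq_inv_mul, mul_smul, heq, smul_smul, inv_mul_cancel₀ hv', one_smul]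

namespace IsTiltedFamily

variable {C : Set H} {γ φ : H} {k : ℝ → H} (F : IsTiltedFamily C γ φ k)
include F

lemma norm_sub_le {l l' : ℝ} (hl : 0 ≤ l) (hl' : 0 ≤ l') : ‖k l - k l'‖ ≤ |l - l'| * ‖φ‖ := by
  refine ((F.proj l hl).norm_sub_le_norm_sub (F.proj l' hl')).trans_eq ?_
  rw [add_sub_add_left_eq_sub, ← sub_smul, norm_smul, Real.norm_eq_abs]

lemma continuousOn : ContinuousOn k (Ici 0) := by
  have : LipschitzOnWith ‖φ‖₊ k (Ici 0) := LipschitzOnWith.of_dist_le_mul fun x hx y hy => by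
    rw [dist_eq_norm, Real.dist_eq, mul_comm]
    exact F.norm_sub_le hx hy
  exact this.continuousOn

lemma continuousOn_cosine : ContinuousOn (fun l => cosine φ (k l)) (Ioi 0) := fun l hl =>
  (continuousAt_cosine F.ne_zero (F.proj_ne_zero l hl)).comp_continuousWithinAt
    ((F.continuousOn l (mem_Ici.2 (le_of_lt hl))).mono Ioi_subset_Ici_self)

/-- The comparison of the directions of two projections: the optimality of `k l`. -/
lemma inner_div_norm_le {l l' : ℝ} (hl : 0 ≤ l) (hl' : 0 ≤ l') (h : k l ≠ 0) (h' : k l' ≠ 0) :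
    ⟪γ, k l'⟫_ℝ / ‖k l'‖ + l * (⟪φ, k l'⟫_ℝ / ‖k l'‖) ≤
      ⟪γ, k l⟫_ℝ / ‖k l‖ + l * (⟪φ, k l⟫_ℝ / ‖k l‖) := by
  have n := norm_pos_iff.2 h
  have n' := norm_pos_iff.2 h'
  have e1 := (F.proj l hl).inner_le_norm_mul (F.proj l' hl').mem
  have e2 := (F.proj l hl).inner_eq
  rw [inner_add_left, inner_smul_left] at e1 e2
  simp only [conj_trivial] at e1 e2
  rw [← mul_div_assoc, ← mul_div_assoc, ← add_div, ← add_div, e2, pow_two, mul_div_assoc,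
    div_self n.ne', mul_one, div_le_iff₀ n']
  exact e1

lemma norm_pos : 0 < ‖φ‖ := norm_pos_iff.2 F.ne_zero

lemma inner_div_norm_eq (l : ℝ) : ⟪φ, k l⟫_ℝ / ‖k l‖ = ‖φ‖ * cosine φ (k l) := by
  rw [cosine, mul_comm ‖φ‖ ‖k l‖, ← div_div, mul_div_cancel₀ _ F.norm_pos.ne']

/-- In the sum of the two optimality comparisons the terms with `γ` cancel. -/
lemma cosine_le_cosine {l l' : ℝ} (hl : 0 < l) (hll : l ≤ l') :
    cosine φ (k l) ≤ cosine φ (k l') := by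
  rcases hll.eq_or_lt with rfl | hlt
  · exact le_rfl
  have hl' := hl.trans hlt
  have e1 := F.inner_div_norm_le hl.le hl'.le (F.proj_ne_zero l hl) (F.proj_ne_zero l' hl')
  have e2 := F.inner_div_norm_le hl'.le hl.le (F.proj_ne_zero l' hl') (F.proj_ne_zero l hl)
  rw [F.inner_div_norm_eq, F.inner_div_norm_eq] at e1 e2
  have h : 0 ≤ (l' - l) * ‖φ‖ * (cosine φ (k l') - cosine φ (k l)) := by linarith
  have h' : 0 < (l' - l) * ‖φ‖ := mul_pos (sub_pos.2 hlt) F.norm_pos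
  exact sub_nonneg.1 (nonneg_of_mul_nonneg_right h h')

lemma cosine_nonneg {l : ℝ} (hl : 0 ≤ l) : 0 ≤ cosine φ (k l) :=
  div_nonneg (F.inner_nonneg _ (F.proj l hl).mem) (by positivity)

/-- `l φ` is its own projection, so `k l` stays within `‖γ‖` of it and `k l / l` tends to `φ`. -/
lemma tendsto_cosine_atTop (hC : IsClosedConvexCone C) :
    Tendsto (fun l => cosine φ (k l)) atTop (𝓝 1) := by
  have hproj : ∀ l : ℝ, 0 ≤ l → IsConeProj C (l • φ) (l • φ) := fun l hl =>
    ⟨hC.smul_mem l hl _ F.mem, by simp, fun w _ => by simp⟩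
  have h1 : Tendsto (fun l : ℝ => l⁻¹ • k l) atTop (𝓝 φ) := by
    rw [tendsto_iff_norm_sub_tendsto_zero]
    refine squeeze_zero' (Eventually.of_forall fun l => norm_nonneg _) ?_
      (g := fun l : ℝ => l⁻¹ * ‖γ‖) (by simpa using tendsto_inv_atTop_zero.mul_const ‖γ‖)
    filter_upwards [eventually_gt_atTop 0] with l hl
    have := (F.proj l hl.le).norm_sub_le_norm_sub (hproj l hl.le)
    rw [add_sub_cancel_right] at this
    have e : l⁻¹ • k l - φ = l⁻¹ • (k l - l • φ) := by
      rw [smul_sub, smul_smul, inv_mul_cancel₀ hl.ne', one_smul]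
    rw [e, norm_smul, Real.norm_of_nonneg (inv_nonneg.2 hl.le)]
    exact mul_le_mul_of_nonneg_left this (inv_nonneg.2 hl.le)
  have h2 := (continuousAt_cosine F.ne_zero F.ne_zero).tendsto.comp h1
  rw [cosine_self F.ne_zero] at h2
  refine h2.congr' ?_
  filter_upwards [eventually_gt_atTop 0] with l hl
  exact cosine_smul_right _ _ (inv_pos.2 hl)

lemma exists_tendsto_cosine :
    ∃ c, Tendsto (fun l => cosine φ (k l)) (𝓝[>] 0) (𝓝 c) ∧ ∀ l, 0 < l → c ≤ cosine φ (k l) := by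
  have hbdd : BddBelow ((fun l => cosine φ (k l)) '' Ioi 0) :=
    ⟨0, by rintro _ ⟨l, hl, rfl⟩; exact F.cosine_nonneg (le_of_lt hl)⟩
  have hmono : MonotoneOn (fun l => cosine φ (k l)) (Ioi 0) := fun l hl l' _ hll =>
    F.cosine_le_cosine hl hll
  refine ⟨_, hmono.tendsto_nhdsGT hbdd, fun l hl => csInf_le hbdd ⟨l, hl, rfl⟩⟩

/-- Equal cosines make the direction of `k l₂` optimal for the tilt `l₁` too, so equality in
Cauchy-Schwarz puts `k l₂` on the ray of `v = k l₁`. The explicit multiple of `v` found below is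
then the projection for every `l` in `(0, l₁]`, and the cosine is constant there. -/
lemma eq_of_cosine_eq (hC : IsClosedConvexCone C) {l₁ l₂ c : ℝ} (h₁ : 0 < l₁) (h₂ : l₁ < l₂)
    (heq : cosine φ (k l₁) = cosine φ (k l₂))
    (hc : Tendsto (fun l => cosine φ (k l)) (𝓝[>] 0) (𝓝 c)) : c = cosine φ (k l₁) := by
  have h₂' := h₁.trans h₂
  have p₁ := F.proj l₁ h₁.le
  have p₂ := F.proj l₂ h₂'.le
  have z₁ := F.proj_ne_zero l₁ h₁
  have z₂ := F.proj_ne_zero l₂ h₂'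
  have n₁ := norm_pos_iff.2 z₁
  have n₂ := norm_pos_iff.2 z₂
  -- the two projections lie on the same ray
  have hray : k l₂ = (‖k l₂‖ / ‖k l₁‖) • k l₁ := by
    refine p₁.eq_smul_of_norm_mul_le p₂.mem z₁ ?_
    have e := F.inner_div_norm_le h₂'.le h₁.le z₂ z₁
    rw [F.inner_div_norm_eq, F.inner_div_norm_eq, heq, add_le_add_iff_right] at e
    have e2 := p₁.inner_eq
    rw [inner_add_left, inner_smul_left] at e2 ⊢
    simp only [conj_trivial] at e2 ⊢
    have e3 : ⟪γ, k l₁⟫_ℝ / ‖k l₁‖ + l₁ * (⟪φ, k l₁⟫_ℝ / ‖k l₁‖) = ‖k l₁‖ := by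
      rw [← mul_div_assoc, ← add_div, e2, pow_two, mul_div_assoc, div_self n₁.ne', mul_one]
    have e4 : ‖k l₁‖ ≤ ⟪γ, k l₂⟫_ℝ / ‖k l₂‖ + l₁ * (⟪φ, k l₂⟫_ℝ / ‖k l₂‖) := by
      rw [F.inner_div_norm_eq] at e3 ⊢
      rw [heq] at e3
      linarith
    rw [← mul_div_assoc, ← add_div, le_div_iff₀ n₂] at e4
    exact e4
  set v := k l₁ with hv
  set r := ‖k l₂‖ / ‖v‖ with hr
  have hr0 : 0 < r := div_pos n₂ n₁
  have hflat := F.flat v p₁.mem 1 r l₁ l₂ one_pos hr0 h₁ h₂ (one_smul ℝ v).symm hray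
  set s := (r - 1) / (l₂ - l₁) with hs
  have hd : 0 < l₂ - l₁ := sub_pos.2 h₂
  have hsr : s * (l₂ - l₁) = r - 1 := div_mul_cancel₀ _ hd.ne'
  have hperp : ⟪φ - s • v, v⟫_ℝ = 0 := by
    have e1 := p₁.inner_self
    have e2 := p₂.inner_self
    rw [hray, inner_smul_right] at e2
    have e2' := (mul_eq_zero.1 e2).resolve_left hr0.ne'
    simp only [inner_sub_left, inner_add_left, inner_smul_left, conj_trivial] at e1 e2' ⊢
    have : (l₂ - l₁) * (⟪φ, v⟫_ℝ - s * ⟪v, v⟫_ℝ) = 0 := by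
      have : (l₂ - l₁) * (s * ⟪v, v⟫_ℝ) = (r - 1) * ⟪v, v⟫_ℝ := by rw [← hsr]; ring
      rw [mul_sub, this]
      linarith
    exact (mul_eq_zero.1 this).resolve_left hd.ne'
  -- The residual at `l` is the one at `l₁` minus `(l₁ - l) (φ - s v)`. It remains in the polar cone
  -- by `hflat` and orthogonal to `v` by `hperp`.
  have hpersist : ∀ l, 0 < l → l ≤ l₁ → 0 ≤ 1 + (l - l₁) * s → k l = (1 + (l - l₁) * s) • v := by
    intro l hl hll ha
    refine (F.proj l hl.le).unique ?_
    have e : γ + l • φ - (1 + (l - l₁) * s) • v =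
        (γ + l₁ • φ - v) - (l₁ - l) • (φ - s • v) := by
      module
    refine ⟨?_, ?_, fun w hw => ?_⟩
    · exact hC.smul_mem _ ha _ p₁.mem
    · rw [e, inner_smul_right, inner_sub_left, inner_smul_left, hperp, p₁.inner_self]
      simp
    · rw [e, inner_sub_left, inner_smul_left]
      have := mul_nonneg (sub_nonneg.2 hll) (hflat w hw)
      simp only [conj_trivial]
      linarith [p₁.inner_nonpos w hw]
  -- If the coefficient were not positive at some `l > 0`, it would vanish at `l₁ - 1 / s ≥ l`, and
  -- the projection there would be `0`.
  have hpos : ∀ l, 0 < l → l ≤ l₁ → 0 < 1 + (l - l₁) * s := by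
    intro l hl hll
    by_contra! hle
    have hs0 : 0 < s := by
      by_contra! hle'
      nlinarith
    have hl' : l ≤ l₁ - 1 / s := by
      rw [le_sub_comm, div_le_iff₀ hs0]
      linarith
    have hz : 1 + (l₁ - 1 / s - l₁) * s = 0 := by
      field_simp
      ring
    have := hpersist (l₁ - 1 / s) (hl.trans_le hl') (by linarith [one_div_pos.2 hs0]) hz.ge
    rw [hz, zero_smul] at this
    exact F.proj_ne_zero _ (hl.trans_le hl') this
  have hconst : Tendsto (fun l => cosine φ (k l)) (𝓝[>] 0) (𝓝 (cosine φ v)) := by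
    refine tendsto_const_nhds.congr' ?_
    filter_upwards [Ioc_mem_nhdsGT h₁] with l hl
    rw [hpersist l hl.1 hl.2 (hpos l hl.1 hl.2).le, cosine_smul_right _ _ (hpos l hl.1 hl.2)]
  exact tendsto_nhds_unique hc hconst

/-- The projections attain every cosine strictly between the limits at `0` and `∞`, once. -/
lemma existsUnique_cosine_eq (hC : IsClosedConvexCone C) {c₀ c : ℝ}
    (hc₀ : Tendsto (fun l => cosine φ (k l)) (𝓝[>] 0) (𝓝 c₀)) (h₀ : c₀ < c) (h₁ : c < 1) :
    ∃ l, 0 < l ∧ cosine φ (k l) = c ∧ ∀ l', 0 < l' → cosine φ (k l') = c → l' = l := by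
  obtain ⟨l₁, hl₁, hl₁'⟩ := ((hc₀.eventually (gt_mem_nhds h₀)).and self_mem_nhdsWithin).exists
  obtain ⟨l₂, hl₂, hl₂'⟩ := (((F.tendsto_cosine_atTop hC).eventually (lt_mem_nhds h₁)).and
    (eventually_gt_atTop 0)).exists
  obtain ⟨l, hl, hlc⟩ := isPreconnected_Ioi.intermediate_value (mem_Ioi.2 hl₁') (mem_Ioi.2 hl₂')
    F.continuousOn_cosine ⟨hl₁.le, hl₂.le⟩
  refine ⟨l, hl, hlc, fun l' hl' hlc' => ?_⟩
  have hl0 : 0 < l := hl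
  simp only at hlc
  rcases lt_trichotomy l' l with h | h | h
  · have := F.eq_of_cosine_eq hC hl' h (hlc'.trans hlc.symm) hc₀
    exact absurd (this.trans hlc') h₀.ne
  · exact h
  · have := F.eq_of_cosine_eq hC hl0 h (hlc.trans hlc'.symm) hc₀
    exact absurd (this.trans hlc) h₀.ne

/-- The direction of `k l` maximises `⟪γ, ·⟫` among the elements of given norm whose inner
product with `φ` is not smaller. -/
lemma inner_le_of_norm_eq {l σ : ℝ} (hl : 0 ≤ l) (hk : k l ≠ 0) {w : H}
    (hw : w ∈ C) (hn : ‖w‖ = σ) (hlw : l * ⟪φ, (σ / ‖k l‖) • k l⟫_ℝ ≤ l * ⟪φ, w⟫_ℝ) :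
    ⟪γ, w⟫_ℝ ≤ ⟪γ, (σ / ‖k l‖) • k l⟫_ℝ ∧
      (⟪γ, (σ / ‖k l‖) • k l⟫_ℝ ≤ ⟪γ, w⟫_ℝ → w = (σ / ‖k l‖) • k l) := by
  have n := norm_pos_iff.2 hk
  have e1 := (F.proj l hl).inner_le_norm_mul hw
  have e2 : ⟪γ, (σ / ‖k l‖) • k l⟫_ℝ + l * ⟪φ, (σ / ‖k l‖) • k l⟫_ℝ = ‖k l‖ * σ := by
    have := (F.proj l hl).inner_eq
    rw [inner_add_left, inner_smul_left] at this
    simp only [conj_trivial] at this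
    rw [inner_smul_right, inner_smul_right]
    have h3 : σ / ‖k l‖ * ⟪γ, k l⟫_ℝ + l * (σ / ‖k l‖ * ⟪φ, k l⟫_ℝ) =
        σ / ‖k l‖ * ‖k l‖ ^ 2 := by rw [← this]; ring
    rw [h3]
    field_simp
  rw [hn, inner_add_left, inner_smul_left] at e1
  simp only [conj_trivial] at e1
  refine ⟨by linarith, fun hle => ?_⟩
  rw [← hn]
  refine (F.proj l hl).eq_smul_of_norm_mul_le hw hk ?_
  rw [inner_add_left, inner_smul_left, hn]
  simp only [conj_trivial]
  linarith

/-- The two optimality comparisons bracket the difference of values between multiples of the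
difference of cosines, with factors `l ‖φ‖` and `l' ‖φ‖`. -/
lemma abs_inner_div_norm_sub_le {l l' b : ℝ} (hl : 0 < l) (hl' : 0 < l') (hb : l ≤ b)
    (hb' : l' ≤ b) : |⟪γ, k l⟫_ℝ / ‖k l‖ - ⟪γ, k l'⟫_ℝ / ‖k l'‖| ≤
      b * ‖φ‖ * |cosine φ (k l) - cosine φ (k l')| := by
  have e1 := F.inner_div_norm_le hl.le hl'.le (F.proj_ne_zero l hl) (F.proj_ne_zero l' hl')
  have e2 := F.inner_div_norm_le hl'.le hl.le (F.proj_ne_zero l' hl') (F.proj_ne_zero l hl)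
  rw [F.inner_div_norm_eq, F.inner_div_norm_eq] at e1 e2
  have hφ := F.norm_pos
  have key : ∀ t, 0 < t → t ≤ b → |t * ‖φ‖ * (cosine φ (k l) - cosine φ (k l'))| ≤
      b * ‖φ‖ * |cosine φ (k l) - cosine φ (k l')| := by
    intro t ht htb
    rw [abs_mul, abs_of_pos (mul_pos ht hφ)]
    gcongr
  have k1 := abs_le.1 (key l hl hb)
  have k2 := abs_le.1 (key l' hl' hb')
  rw [abs_le]
  constructor <;> linarith [k1.1, k1.2, k2.1, k2.2]

/-- The maximal value depends continuously on the prescribed cosine. -/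
lemma continuousOn_value {c₀ : ℝ} {L : ℝ → ℝ} (hpos : ∀ c ∈ Ioo c₀ 1, 0 < L c)
    (hL : ∀ c ∈ Ioo c₀ 1, cosine φ (k (L c)) = c) :
    ContinuousOn (fun c => ⟪γ, k (L c)⟫_ℝ / ‖k (L c)‖) (Ioo c₀ 1) := by
  intro c hc
  -- The Lipschitz constant involves the multiplier, for which no bound is available up to cosine
  -- `1`; to the left of `b` it is at most `L b`.
  obtain ⟨b, hb, hb1⟩ := exists_between hc.2
  have hmem : ∀ x ∈ Ioo c₀ b, x ∈ Ioo c₀ 1 := fun x hx => ⟨hx.1, hx.2.trans hb1⟩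
  have hbm : b ∈ Ioo c₀ 1 := ⟨hc.1.trans hb, hb1⟩
  have hle : ∀ x ∈ Ioo c₀ b, L x ≤ L b := by
    intro x hx
    by_contra! hlt
    have := F.cosine_le_cosine (hpos b hbm) hlt.le
    rw [hL b hbm, hL x (hmem x hx)] at this
    exact absurd hx.2 (not_lt.2 this)
  have hlip : LipschitzOnWith (Real.toNNReal (L b * ‖φ‖))
      (fun c => ⟪γ, k (L c)⟫_ℝ / ‖k (L c)‖) (Ioo c₀ b) := by
    refine LipschitzOnWith.of_dist_le_mul fun x hx y hy => ?_
    rw [Real.dist_eq, Real.dist_eq, Real.coe_toNNReal _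
      (mul_nonneg (hpos b hbm).le (norm_nonneg _))]
    have := F.abs_inner_div_norm_sub_le (hpos x (hmem x hx)) (hpos y (hmem y hy)) (hle x hx)
      (hle y hy)
    rwa [hL x (hmem x hx), hL y (hmem y hy)] at this
  exact (hlip.continuousOn.continuousAt (Ioo_mem_nhds hc.1 hb)).continuousWithinAt

/-- The value equals `‖k l‖ - l ⟪φ, k l⟫ / ‖k l‖`, and nonexpansiveness gives `‖k l‖ ≤ l ‖φ‖`, so
both terms are at most `l ‖φ‖` in absolute value. -/
lemma tendsto_value_of_eq_zero (h0 : k 0 = 0) :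
    Tendsto (fun l => ⟪γ, k l⟫_ℝ / ‖k l‖) (𝓝[>] 0) (𝓝 0) := by
  refine squeeze_zero_norm' (a := fun l => 2 * (l * ‖φ‖)) ?_ ?_
  · filter_upwards [self_mem_nhdsWithin] with l hl
    have hl0 : 0 < l := hl
    have n := norm_pos_iff.2 (F.proj_ne_zero l hl0)
    have e1 := (F.proj l hl0.le).inner_eq
    rw [inner_add_left, inner_smul_left] at e1
    simp only [conj_trivial] at e1
    have e2 : ⟪γ, k l⟫_ℝ / ‖k l‖ + l * (⟪φ, k l⟫_ℝ / ‖k l‖) = ‖k l‖ := by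
      rw [← mul_div_assoc, ← add_div, e1, pow_two, mul_div_assoc, div_self n.ne', mul_one]
    have e3 := F.norm_sub_le hl0.le le_rfl
    rw [h0, sub_zero, sub_zero, abs_of_pos hl0] at e3
    have e4 : |⟪φ, k l⟫_ℝ / ‖k l‖| ≤ ‖φ‖ := by
      rw [abs_div, abs_norm, div_le_iff₀ n]
      exact abs_real_inner_le_norm _ _
    have e5 : |l * (⟪φ, k l⟫_ℝ / ‖k l‖)| ≤ l * ‖φ‖ := by
      rw [abs_mul, abs_of_pos hl0]
      gcongr
    rw [Real.norm_eq_abs, abs_le]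
    have := abs_le.1 e5
    constructor <;> linarith [this.1, this.2]
  · have : Tendsto (fun l : ℝ => 2 * (l * ‖φ‖)) (𝓝 0) (𝓝 (2 * (0 * ‖φ‖))) :=
      (tendsto_id.mul_const _).const_mul _
    simp only [zero_mul, mul_zero] at this
    exact this.mono_left nhdsWithin_le_nhds

lemma tendsto_cosine_zero (h0 : k 0 ≠ 0) :
    Tendsto (fun l => cosine φ (k l)) (𝓝[>] 0) (𝓝 (cosine φ (k 0))) :=
  (continuousAt_cosine F.ne_zero h0).tendsto.comp
    ((F.continuousOn 0 self_mem_Ici).mono_left (nhdsWithin_mono _ Ioi_subset_Ici_self))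

end IsTiltedFamily

end Tilted

/-! ### The tilted family of a setting -/

section Setting

variable {g : ℝ → ℝ} {F : Measure ℝ} {μF σF μ σ : ℝ}

lemma Setting.memLp_quantile (S : Setting g F μF σF) : MemLp (quantile F) 2 unif :=
  S.moments.isIsotonic.sq_integrable

lemma memLp_tilted (hw : MemLp (weight g) 2 unif) (hq : MemLp (quantile F) 2 unif) (l : ℝ) :
    MemLp (tilted g F l) 2 unif :=
  hw.add (hq.const_mul l)

lemma isIsotonicProjection_kUp (hw : MemLp (weight g) 2 unif) (hq : MemLp (quantile F) 2 unif)
    (l : ℝ) : IsIsotonicProjection (tilted g F l) (kUp g F l) :=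
  isIsotonicProjection_isotonicProjection (memLp_tilted hw hq l)

lemma isConeProj_kUp (hw : MemLp (weight g) 2 unif) (hq : MemLp (quantile F) 2 unif) (l : ℝ) :
    IsConeProj isoCone (ctr (weight g) + l • ctr (quantile F)) (ctr (kUp g F l)) := by
  have h : ctr (tilted g F l) = ctr (weight g) + l • ctr (quantile F) := by
    rw [← ctr_const_mul hq, ← ctr_add hw (hq.const_mul l)]
    rfl
  rw [← h]
  exact ((isIsotonicProjection_iff (memLp_tilted hw hq l)).1
    (isIsotonicProjection_kUp hw hq l)).2.2

lemma Setting.isIsotonic_kUp (S : Setting g F μF σF) (l : ℝ) : IsIsotonic (kUp g F l) :=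
  (isIsotonicProjection_kUp S.weight_sq S.memLp_quantile l).1

lemma Setting.isConeProj (S : Setting g F μF σF) (l : ℝ) :
    IsConeProj isoCone (ctr (weight g) + l • ctr (quantile F)) (ctr (kUp g F l)) :=
  isConeProj_kUp S.weight_sq S.memLp_quantile l

lemma HasMoments.norm_ctr_quantile {G : Measure ℝ} (hG : HasMoments G μ σ) (hσ : 0 ≤ σ) :
    ‖ctr (quantile G)‖ = σ := by
  have := hG.variance_quantile
  rw [variance_eq_norm_sq hG.isIsotonic.sq_integrable] at this
  exact (pow_left_inj₀ (norm_nonneg _) hσ two_ne_zero).1 this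

lemma Setting.norm_quantile (S : Setting g F μF σF) : ‖ctr (quantile F)‖ = σF :=
  S.moments.norm_ctr_quantile S.sigma_pos.le

/-- Once a projection is constant, so are those with a smaller tilt. -/
lemma ctr_kUp_eq_zero_of_le {γ φ k k' : Lp ℝ 2 unif} {l l' : ℝ} (hφ : φ ∈ isoCone)
    (hl : l' ≤ l) (h : IsConeProj isoCone (γ + l • φ) k)
    (h' : IsConeProj isoCone (γ + l' • φ) k') (hk : k = 0) : k' = 0 := by
  subst hk
  refine h'.unique ⟨isClosedConvexCone_isoCone.zero_mem, inner_zero_right _, fun w hw => ?_⟩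
  have h1 := h.inner_nonpos w hw
  have h2 := mul_nonneg (sub_nonneg.2 hl) (inner_nonneg_of_mem_isoCone hφ hw)
  simp only [sub_zero, inner_add_left, inner_smul_left, conj_trivial] at h1 ⊢
  linarith

/-- Since the infimum `λ^↑` is `0`, some smaller tilt has a non-constant projection, whereas
constancy at `l` would pass down to it. -/
lemma Setting.ctr_kUp_ne_zero (S : Setting g F μF σF) {l : ℝ} (hl : 0 < l) :
    ctr (kUp g F l) ≠ 0 := by
  intro h0
  have hlt : lambdaUp g F < (l : EReal) := by
    rw [S.lambdaUp_eq]
    exact_mod_cast hl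
  obtain ⟨_, ⟨l', ⟨-, hl'⟩, rfl⟩, hll⟩ := sInf_lt_iff.1 hlt
  refine hl' ((S.isIsotonic_kUp l').isConstant_iff.2 ?_)
  exact ctr_kUp_eq_zero_of_le S.moments.isIsotonic.ctr_mem
    (EReal.coe_lt_coe_iff.1 hll).le (S.isConeProj l) (S.isConeProj l') h0

lemma Setting.isTiltedFamily (S : Setting g F μF σF) :
    IsTiltedFamily isoCone (ctr (weight g)) (ctr (quantile F)) (fun l => ctr (kUp g F l)) where
  mem := S.moments.isIsotonic.ctr_mem
  ne_zero := norm_ne_zero_iff.1 (by rw [S.norm_quantile]; exact S.sigma_pos.ne')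
  proj l _ := S.isConeProj l
  proj_ne_zero l hl := S.ctr_kUp_ne_zero hl
  inner_nonneg w hw := inner_nonneg_of_mem_isoCone S.moments.isIsotonic.ctr_mem hw
  flat v hv a₁ a₂ l₁ l₂ ha₁ ha₂ _ hl h₁ h₂ w hw := by
    have p₁ := S.isConeProj l₁
    have p₂ := S.isConeProj l₂
    rw [show ctr (kUp g F l₁) = a₁ • v from h₁] at p₁
    rw [show ctr (kUp g F l₂) = a₂ • v from h₂] at p₂
    refine inner_nonneg_of_isConeProj_smul S.moments.isIsotonic.ctr_mem hv ha₁ ha₂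
      (sub_pos.2 hl) p₁ p₂ ?_ hw
    rw [add_sub_add_left_eq_sub, ← sub_smul]

lemma Setting.corrU_eq_cosine (S : Setting g F μF σF) (l : ℝ) :
    corrU (quantile F) (kUp g F l) = cosine (ctr (quantile F)) (ctr (kUp g F l)) :=
  corrU_eq S.memLp_quantile (S.isIsotonic_kUp l).sq_integrable

lemma Setting.tendsto_cZero (S : Setting g F μF σF) :
    Tendsto (fun l : ℝ => corrU (quantile F) (kUp g F l)) (𝓝[>] 0) (𝓝 (cZero g F)) := by
  obtain ⟨c, hc, -⟩ := S.isTiltedFamily.exists_tendsto_cosine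
  refine tendsto_nhds_limUnder ⟨c, ?_⟩
  simp_rw [S.corrU_eq_cosine]
  exact hc

lemma Setting.tendsto_cosine_cZero (S : Setting g F μF σF) :
    Tendsto (fun l : ℝ => cosine (ctr (quantile F)) (ctr (kUp g F l))) (𝓝[>] 0)
      (𝓝 (cZero g F)) := by
  simpa only [S.corrU_eq_cosine] using S.tendsto_cZero

lemma Setting.cZero_le (S : Setting g F μF σF) {l : ℝ} (hl : 0 < l) :
    cZero g F ≤ cosine (ctr (quantile F)) (ctr (kUp g F l)) := by
  obtain ⟨c, hc, hle⟩ := S.isTiltedFamily.exists_tendsto_cosine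
  rw [tendsto_nhds_unique S.tendsto_cosine_cZero hc]
  exact hle l hl

/-! ### The standardised projections -/

lemma hUp_eq (g : ℝ → ℝ) (F : Measure ℝ) (μ σ l : ℝ) : hUp g F μ σ l =
    fun u => σ / stdU (kUp g F l) * kUp g F l u +
      (μ - σ / stdU (kUp g F l) * meanU (kUp g F l)) := by
  funext u
  rw [hUp]
  ring

/-- No nondegeneracy is needed: for constant `k_l` division by zero makes the function the constant
`μ`. -/
lemma Setting.isIsotonic_hUp (S : Setting g F μF σF) (hσ : 0 ≤ σ) (l : ℝ) :
    IsIsotonic (hUp g F μ σ l) := by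
  rw [hUp_eq]
  exact ((S.isIsotonic_kUp l).const_mul (div_nonneg hσ (Real.sqrt_nonneg _))).add_const _

lemma Setting.ctr_hUp (S : Setting g F μF σF) (l : ℝ) :
    ctr (hUp g F μ σ l) = (σ / ‖ctr (kUp g F l)‖) • ctr (kUp g F l) := by
  have h2 := (S.isIsotonic_kUp l).sq_integrable
  rw [hUp_eq, ctr_add_const (h2.const_mul _), ctr_const_mul h2, stdU_eq h2]

lemma Setting.meanU_hUp (S : Setting g F μF σF) (l : ℝ) : meanU (hUp g F μ σ l) = μ := by
  have h2 := (S.isIsotonic_kUp l).sq_integrable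
  rw [hUp_eq, meanU_add_const (h2.const_mul _), meanU_const_mul]
  ring

lemma Setting.hasMoments_law_hUp (S : Setting g F μF σF) (hσ : 0 ≤ σ) {l : ℝ}
    (hl : ctr (kUp g F l) ≠ 0) : HasMoments (law (hUp g F μ σ l)) μ σ := by
  have h2 := (S.isIsotonic_hUp (μ := μ) hσ l).sq_integrable
  refine hasMoments_law h2 (S.meanU_hUp l) ?_
  rw [variance_eq_norm_sq h2, S.ctr_hUp, norm_smul, Real.norm_of_nonneg (by positivity),
    div_mul_cancel₀ _ (norm_ne_zero_iff.2 hl)]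

lemma IsIsotonic.ctr_quantile_law {h : ℝ → ℝ} (hh : IsIsotonic h) :
    ctr (quantile (law h)) = ctr h :=
  ctr_congr (ae_unif_mem.mono (quantile_law hh))

lemma Setting.inner_quantile_hUp (S : Setting g F μF σF) (l : ℝ) :
    ⟪ctr (quantile F), ctr (hUp g F μ σ l)⟫_ℝ =
      σ * σF * cosine (ctr (quantile F)) (ctr (kUp g F l)) := by
  rw [S.ctr_hUp, inner_smul_right, cosine, S.norm_quantile]
  have := S.sigma_pos.ne'
  field_simp

/-! ### Reduction to the Hilbert space -/

/-- With both means and variances fixed, the inner product of the centred quantile functions is the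
only free term of the expanded square. -/
lemma dW_eq_rpow {F G : Measure ℝ} (hF : HasMoments F μF σF) (hG : HasMoments G μ σ) :
    dW F G = ENNReal.ofReal (lowerCrit μF σF μ σ +
      2 * (σ * σF - ⟪ctr (quantile F), ctr (quantile G)⟫_ℝ)) ^ (1 / 2 : ℝ) := by
  have := hF.prob
  have := hG.prob
  have f2 := hF.isIsotonic.sq_integrable
  have g2 := hG.isIsotonic.sq_integrable
  rw [dW_eq, eLpNorm_two_eq]
  congr 1
  have h1 : ∀ u, ‖quantile F u - quantile G u‖ₑ ^ 2 =
      ENNReal.ofReal ((quantile F u - quantile G u) ^ 2) := fun u => by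
    rw [← sq_abs, ENNReal.ofReal_pow (abs_nonneg _), ← Real.enorm_eq_ofReal_abs]
  simp_rw [h1]
  have hint : Integrable (fun u => (quantile F u - quantile G u) ^ 2) unif :=
    (f2.sub g2).integrable_sq
  rw [← ofReal_integral_eq_lintegral_ofReal hint (Eventually.of_forall fun u => sq_nonneg _),
    integral_sub_sq_eq f2 g2, hF.meanU_quantile,
    hG.meanU_quantile, norm_sub_sq_real, ← variance_eq_norm_sq f2, ← variance_eq_norm_sq g2,
    hF.variance_quantile, hG.variance_quantile, lowerCrit]
  congr 1
  ring

lemma lowerCrit_nonneg : 0 ≤ lowerCrit μF σF μ σ := by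
  unfold lowerCrit
  positivity

lemma mem_uncertaintySet_iff {F G : Measure ℝ} (hF : HasMoments F μF σF) {ε : ℝ≥0∞} :
    G ∈ uncertaintySet F μ σ ε ↔ HasMoments G μ σ ∧
      ENNReal.ofReal (lowerCrit μF σF μ σ +
        2 * (σ * σF - ⟪ctr (quantile F), ctr (quantile G)⟫_ℝ)) ≤ ε := by
  refine and_congr_right fun hG => ?_
  rw [dW_eq_rpow hF hG]
  exact ENNReal.rpow_le_rpow_iff (by norm_num)

lemma Setting.riskMeasure_eq (S : Setting g F μF σF) {G : Measure ℝ} (hG : HasMoments G μ σ) :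
    riskMeasure g G = ((μ + ⟪ctr (weight g), ctr (quantile G)⟫_ℝ : ℝ) : EReal) := by
  have h2 := hG.isIsotonic.sq_integrable
  rw [WorstCase.riskMeasure_eq S.distortion S.abs_cont S.weight_sq h2,
    inner_ctr_eq_sub S.weight_sq h2, hG.meanU_quantile, integral_weight S.distortion S.abs_cont]
  congr 1
  ring

lemma Setting.riskMeasure_law_hUp (S : Setting g F μF σF) (hσ : 0 ≤ σ) {l : ℝ}
    (hl : ctr (kUp g F l) ≠ 0) : riskMeasure g (law (hUp g F μ σ l)) =
      ((μ + σ * (⟪ctr (weight g), ctr (kUp g F l)⟫_ℝ / ‖ctr (kUp g F l)‖) : ℝ) : EReal) := by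
  rw [S.riskMeasure_eq (S.hasMoments_law_hUp hσ hl),
    (S.isIsotonic_hUp hσ l).ctr_quantile_law, S.ctr_hUp, inner_smul_right]
  congr 2
  ring

lemma Setting.dW_law_hUp (S : Setting g F μF σF) (hσ : 0 ≤ σ) {l : ℝ}
    (hl : ctr (kUp g F l) ≠ 0) : dW F (law (hUp g F μ σ l)) =
      ENNReal.ofReal (lowerCrit μF σF μ σ + 2 * σ * σF *
        (1 - cosine (ctr (quantile F)) (ctr (kUp g F l)))) ^ (1 / 2 : ℝ) := by
  rw [dW_eq_rpow S.moments (S.hasMoments_law_hUp hσ hl),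
    (S.isIsotonic_hUp hσ l).ctr_quantile_law, S.inner_quantile_hUp]
  congr 3
  ring

lemma Setting.law_hUp_mem (S : Setting g F μF σF) (hσ : 0 ≤ σ) {l : ℝ} {ε : ℝ≥0∞}
    (hl : ctr (kUp g F l) ≠ 0) (hε : ENNReal.ofReal (lowerCrit μF σF μ σ + 2 * σ * σF *
        (1 - cosine (ctr (quantile F)) (ctr (kUp g F l)))) ≤ ε) :
    law (hUp g F μ σ l) ∈ uncertaintySet F μ σ ε := by
  refine ⟨S.hasMoments_law_hUp hσ hl, ?_⟩
  rw [S.dW_law_hUp hσ hl]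
  exact ENNReal.rpow_le_rpow hε (by norm_num)

/-- The Lagrangian step. The factor `l` in `hopt` encodes complementary slackness: nothing is
required when `l = 0`. Uniqueness passes from vectors to laws because the means also agree. -/
lemma Setting.solves (S : Setting g F μF σF) (hσ : 0 < σ) {l : ℝ} (hl0 : 0 ≤ l) {ε : ℝ≥0∞}
    (hl : ctr (kUp g F l) ≠ 0) (hε : ENNReal.ofReal (lowerCrit μF σF μ σ + 2 * σ * σF *
        (1 - cosine (ctr (quantile F)) (ctr (kUp g F l)))) ≤ ε)
    (hopt : ∀ G ∈ uncertaintySet F μ σ ε, l * (σ * σF *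
      cosine (ctr (quantile F)) (ctr (kUp g F l))) ≤
        l * ⟪ctr (quantile F), ctr (quantile G)⟫_ℝ) : Solves g F μ σ ε l := by
  have hiso : IsIsotonic (hUp g F μ σ l) := S.isIsotonic_hUp hσ.le l
  have hmem := S.law_hUp_mem hσ.le hl hε
  have key : ∀ G ∈ uncertaintySet F μ σ ε,
      riskMeasure g G ≤ riskMeasure g (law (hUp g F μ σ l)) ∧
        (riskMeasure g (law (hUp g F μ σ l)) ≤ riskMeasure g G → G = law (hUp g F μ σ l)) := by
    intro G hG
    have := hG.1.prob
    obtain ⟨h1, h2⟩ := S.isTiltedFamily.inner_le_of_norm_eq hl0 hl hG.1.isIsotonic.ctr_mem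
      (hG.1.norm_ctr_quantile hσ.le)
      (by rw [← S.ctr_hUp (μ := μ), S.inner_quantile_hUp]; exact hopt G hG)
    rw [← S.ctr_hUp (μ := μ)] at h1 h2
    rw [S.riskMeasure_eq hG.1, S.riskMeasure_eq hmem.1, hiso.ctr_quantile_law,
      EReal.coe_le_coe_iff, EReal.coe_le_coe_iff, add_le_add_iff_left, add_le_add_iff_left]
    refine ⟨h1, fun hle => ?_⟩
    have heq : EqOn (quantile G) (hUp g F μ σ l) (Ioo 0 1) :=
      hG.1.isIsotonic.eqOn_of_ctr_eq hiso (h2 hle)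
        (by rw [hG.1.meanU_quantile, S.meanU_hUp])
    rw [← law_quantile G]
    exact Measure.map_congr (ae_unif_mem.mono heq)
  refine ⟨quantile_law hiso, ?_, ?_, ?_⟩
  · ext G
    constructor
    · rintro ⟨hG, hmax⟩
      exact (key G hG).2 (hmax _ hmem)
    · rintro rfl
      exact ⟨hmem, fun G' hG' => (key G' hG').1⟩
  · exact le_antisymm (iSup₂_le fun G hG => (key G hG).1)
      (le_iSup₂_of_le (law (hUp g F μ σ l)) hmem le_rfl)
  · rw [S.riskMeasure_law_hUp hσ.le hl, stdU_eq S.weight_sq,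
      corrU_eq S.weight_sq (S.isIsotonic_kUp l).sq_integrable]
    congr 2
    -- If the centred weight is zero, both sides reduce to `μ`, the correlation being `0` by
    -- division by zero.
    rcases eq_or_ne (ctr (weight g)) 0 with h0 | h0
    · simp [h0]
    · have := norm_ne_zero_iff.2 h0
      field_simp

/-! ### Binding and non-binding constraints -/

/-- On this range of `ε`, prescribing the distance is the same as prescribing the cosine, and the
cosines that occur lie in `(c₀, 1)`, where the multiplier exists and is unique. -/
lemma Setting.case_binding (S : Setting g F μF σF) (hσ : 0 < σ) : ∃ Λ : ℝ≥0∞ → ℝ,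
    (∀ ε : ℝ≥0∞, ENNReal.ofReal (lowerCrit μF σF μ σ) < ε →
      ε < ENNReal.ofReal (upperCrit g F μF σF μ σ) →
      (0 < Λ ε ∧ dW F (law (hUp g F μ σ (Λ ε))) = ε ^ (1 / 2 : ℝ) ∧
        ∀ l : ℝ, 0 < l → dW F (law (hUp g F μ σ l)) = ε ^ (1 / 2 : ℝ) → l = Λ ε) ∧
      Solves g F μ σ ε (Λ ε)) ∧
    ContinuousOn (fun ε : ℝ≥0∞ => riskMeasure g (law (hUp g F μ σ (Λ ε))))
      (Ioo (ENNReal.ofReal (lowerCrit μF σF μ σ))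
        (ENNReal.ofReal (upperCrit g F μF σF μ σ))) := by
  set m := lowerCrit μF σF μ σ with hm
  have hm0 : 0 ≤ m := lowerCrit_nonneg
  have hss : 0 < 2 * σ * σF := by have := S.sigma_pos; positivity
  have hex := fun c (hc : c ∈ Ioo (cZero g F) 1) => S.isTiltedFamily.existsUnique_cosine_eq
    isClosedConvexCone_isoCone S.tendsto_cosine_cZero hc.1 hc.2
  have hex' : ∀ c : ℝ, ∃ l : ℝ, c ∈ Ioo (cZero g F) 1 → 0 < l ∧
      cosine (ctr (quantile F)) (ctr (kUp g F l)) = c ∧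
      ∀ l', 0 < l' → cosine (ctr (quantile F)) (ctr (kUp g F l')) = c → l' = l := by
    intro c
    by_cases hc : c ∈ Ioo (cZero g F) 1
    · obtain ⟨l, hl⟩ := hex c hc
      exact ⟨l, fun _ => hl⟩
    · exact ⟨0, fun h => absurd h hc⟩
  choose L hL using hex'
  -- The cosine at which the Wasserstein constraint is tight, from `ε = m + 2 σ σF (1 - c)`.
  set c : ℝ≥0∞ → ℝ := fun ε => 1 - (ε.toReal - m) / (2 * σ * σF) with hcdef
  have hcm : ∀ ε : ℝ≥0∞, ENNReal.ofReal m < ε → ε < ENNReal.ofReal (upperCrit g F μF σF μ σ) →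
      ε ≠ ⊤ ∧ c ε ∈ Ioo (cZero g F) 1 := by
    intro ε h1 h2
    have htop : ε ≠ ⊤ := ne_top_of_lt h2
    refine ⟨htop, ?_, ?_⟩
    · have := (ENNReal.lt_ofReal_iff_toReal_lt htop).1 h2
      have h3 : (ε.toReal - m) / (2 * σ * σF) < 1 - cZero g F := by
        rw [div_lt_iff₀ hss]
        rw [upperCrit] at this
        linarith
      simp only [hcdef]
      linarith
    · have := (ENNReal.ofReal_lt_iff_lt_toReal hm0 htop).1 h1
      have h3 : 0 < (ε.toReal - m) / (2 * σ * σF) := div_pos (by linarith) hss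
      simp only [hcdef]
      linarith
  have hce : ∀ ε : ℝ≥0∞, m + 2 * σ * σF * (1 - c ε) = ε.toReal := by
    intro ε
    simp only [hcdef, sub_sub_cancel]
    rw [mul_div_cancel₀ _ hss.ne']
    ring
  refine ⟨fun ε => L (c ε), fun ε h1 h2 => ?_, ?_⟩
  · obtain ⟨htop, hc⟩ := hcm ε h1 h2
    obtain ⟨p1, p2, p3⟩ := hL _ hc
    have hk := S.ctr_kUp_ne_zero p1
    refine ⟨⟨p1, ?_, fun l hl hdW => p3 l hl ?_⟩, S.solves hσ p1.le hk ?_ fun G hG => ?_⟩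
    · rw [S.dW_law_hUp hσ.le hk, p2, hce, ENNReal.ofReal_toReal htop]
    · rw [S.dW_law_hUp hσ.le (S.ctr_kUp_ne_zero hl)] at hdW
      have h3 := ENNReal.rpow_left_injective (by norm_num : (1 / 2 : ℝ) ≠ 0) hdW
      have hle1 : cosine (ctr (quantile F)) (ctr (kUp g F l)) ≤ 1 :=
        div_le_one_of_le₀ (real_inner_le_norm _ _) (by positivity)
      have h4 := congrArg ENNReal.toReal h3
      rw [ENNReal.toReal_ofReal (by
        have := mul_nonneg hss.le (sub_nonneg.2 hle1)
        linarith), ← hce ε] at h4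
      have h5 := mul_left_cancel₀ hss.ne' (add_left_cancel h4)
      linarith
    · rw [p2, hce, ENNReal.ofReal_toReal htop]
    · refine mul_le_mul_of_nonneg_left ?_ p1.le
      have := ((mem_uncertaintySet_iff S.moments).1 hG).2
      have := (ENNReal.ofReal_le_iff_le_toReal htop).1 this
      rw [← hce ε] at this
      rw [p2]
      linarith
  · have hv := S.isTiltedFamily.continuousOn_value (c₀ := cZero g F) (L := L)
      (fun c hc => (hL c hc).1) (fun c hc => (hL c hc).2.1)
    have hcc : ContinuousOn c (Ioo (ENNReal.ofReal m)
        (ENNReal.ofReal (upperCrit g F μF σF μ σ))) := by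
      have : ContinuousOn ENNReal.toReal (Ioo (ENNReal.ofReal m)
          (ENNReal.ofReal (upperCrit g F μF σF μ σ))) :=
        ENNReal.continuousOn_toReal.mono fun ε hε => ne_top_of_lt hε.2
      exact continuousOn_const.sub ((this.sub continuousOn_const).div_const _)
    have hcomp := hv.comp hcc fun ε hε => (hcm ε hε.1 hε.2).2
    have hreal := continuous_coe_real_ereal.comp_continuousOn
      (continuousOn_const (c := μ).add (continuousOn_const (c := σ).mul hcomp))
    refine hreal.congr fun ε hε => ?_
    exact S.riskMeasure_law_hUp hσ.le (S.ctr_kUp_ne_zero (hL _ (hcm ε hε.1 hε.2).2).1)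

/-- By continuity `c₀` is the cosine at `l = 0`, so the bound on `ε` says exactly that `h_0` is
feasible, and the multiplier `0` works. -/
lemma Setting.case_not_constant (S : Setting g F μF σF) (hσ : 0 < σ) {ε : ℝ≥0∞}
    (hε : ENNReal.ofReal (upperCrit g F μF σF μ σ) ≤ ε) (h0 : ¬ IsConstant (kUp g F 0)) :
    Solves g F μ σ ε 0 := by
  have hk : ctr (kUp g F 0) ≠ 0 := fun h => h0 ((S.isIsotonic_kUp 0).isConstant_iff.2 h)
  have hc := tendsto_nhds_unique S.tendsto_cosine_cZero (S.isTiltedFamily.tendsto_cosine_zero hk)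
  refine S.solves hσ le_rfl hk ?_ fun G _ => by simp
  rw [← hc]
  exact hε

lemma Setting.inner_weight_nonpos (S : Setting g F μF σF) (h0 : IsConstant (kUp g F 0))
    {w : Lp ℝ 2 unif} (hw : w ∈ isoCone) : ⟪ctr (weight g), w⟫_ℝ ≤ 0 := by
  have := (S.isConeProj 0).inner_nonpos w hw
  rwa [(S.isIsotonic_kUp 0).isConstant_iff.1 h0, zero_smul, add_zero, sub_zero] at this

/-- The upper bound holds because `γ` is polar to the cone. All `h_l` with `l > 0` are feasible, as
their cosines are at least `c₀`, and their values tend to `μ` as `l ↓ 0`. -/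
lemma Setting.case_constant (S : Setting g F μF σF) (hσ : 0 < σ) {ε : ℝ≥0∞}
    (hε : ENNReal.ofReal (upperCrit g F μF σF μ σ) ≤ ε) (h0 : IsConstant (kUp g F 0)) :
    worstValue g F μ σ ε = (μ : EReal) := by
  refine le_antisymm (iSup₂_le fun G hG => ?_) ?_
  · rw [S.riskMeasure_eq hG.1, EReal.coe_le_coe_iff]
    linarith [S.inner_weight_nonpos h0 hG.1.isIsotonic.ctr_mem]
  · have hz := (S.isIsotonic_kUp 0).isConstant_iff.1 h0
    have ht := S.isTiltedFamily.tendsto_value_of_eq_zero hz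
    have ht' := ((continuous_coe_real_ereal.tendsto (μ + σ * 0)).comp
      ((ht.const_mul σ).const_add μ))
    rw [mul_zero, add_zero] at ht'
    refine le_of_tendsto ht' ?_
    filter_upwards [self_mem_nhdsWithin] with l hl
    have hk := S.ctr_kUp_ne_zero (mem_Ioi.1 hl)
    refine (S.riskMeasure_law_hUp hσ.le hk).symm.trans_le ?_
    refine le_iSup₂_of_le (law (hUp g F μ σ l)) (S.law_hUp_mem hσ.le hk ?_) le_rfl
    refine le_trans (ENNReal.ofReal_le_ofReal ?_) hε
    rw [upperCrit]
    have h1 := S.cZero_le (mem_Ioi.1 hl)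
    have hss : 0 < 2 * σ * σF := by have := S.sigma_pos; positivity
    nlinarith [mul_le_mul_of_nonneg_left h1 hss.le]

end Setting

/-! ### An example in which the worst-case value is not attained -/

/-- A distortion function whose weight function is `1 + (1 - u) (1 - 3 u)`. -/
def cubic (x : ℝ) : ℝ := x - x ^ 2 + x ^ 3

lemma isDistortion_cubic : IsDistortion cubic where
  mono x hx y hy hxy := by
    have h : cubic y - cubic x = (y - x) * (1 - (x + y) + (x ^ 2 + x * y + y ^ 2)) := by
      unfold cubic; ring
    have h2 : 0 ≤ 1 - (x + y) + (x ^ 2 + x * y + y ^ 2) := by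
      nlinarith [sq_nonneg (x + y - 1), sq_nonneg x, sq_nonneg y, sq_nonneg (x - y)]
    have := mul_nonneg (sub_nonneg.2 hxy) h2
    linarith
  zero := by simp [cubic]
  one := by simp [cubic]

lemma absolutelyContinuous_cubic : AbsolutelyContinuousOnInterval cubic 0 1 := by
  have : LipschitzOnWith 3 cubic (uIcc 0 1) := by
    rw [uIcc_of_le zero_le_one]
    refine LipschitzOnWith.of_dist_le_mul fun x hx y hy => ?_
    have h : cubic x - cubic y = (1 - (x + y) + (x ^ 2 + x * y + y ^ 2)) * (x - y) := by
      unfold cubic; ring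
    rw [Real.dist_eq, Real.dist_eq, h, abs_mul]
    refine mul_le_mul_of_nonneg_right ?_ (abs_nonneg _)
    obtain ⟨x0, x1⟩ := hx
    obtain ⟨y0, y1⟩ := hy
    rw [abs_le]
    push_cast
    constructor <;> nlinarith [mul_nonneg x0 y0]
  exact this.absolutelyContinuousOnInterval

lemma weight_cubic (u : ℝ) : weight cubic u = 1 + (1 - u) * (1 - 3 * u) := by
  have h : HasDerivAt cubic (1 - 2 * (1 - u) + 3 * (1 - u) ^ 2) (1 - u) := by
    have := ((hasDerivAt_id (1 - u)).sub (hasDerivAt_pow 2 (1 - u))).add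
      (hasDerivAt_pow 3 (1 - u))
    convert! this using 1
    simp
  rw [weight, h.hasDerivWithinAt.derivWithin (uniqueDiffWithinAt_Iic _)]
  ring

lemma memLp_weight_cubic : MemLp (weight cubic) 2 unif := by
  have hm : Measurable (weight cubic) := by
    rw [funext weight_cubic]
    fun_prop
  refine MemLp.of_bound hm.aestronglyMeasurable 3 ?_
  filter_upwards [ae_unif_mem] with u hu
  rw [weight_cubic, Real.norm_eq_abs, abs_le]
  constructor <;> nlinarith [hu.1, hu.2]

lemma coeFn_ctr_weight_cubic :
    ctr (weight cubic) =ᵐ[unif] fun u => (1 - u) * (1 - 3 * u) := by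
  filter_upwards [coeFn_ctr memLp_weight_cubic] with u hu
  rw [hu, weight_cubic, integral_weight isDistortion_cubic absolutelyContinuous_cubic]
  ring

/-- On `(0, 1)`, `γ - 1` changes sign once, from positive to negative at `1 / 3`. After subtracting
`k (1 / 3)` the integrand is non-positive pointwise, and a zero integral forces `k` to be almost
everywhere constant. -/
lemma inner_weight_cubic {k : ℝ → ℝ} (hk : IsIsotonic k) :
    ⟪ctr (weight cubic), ctr k⟫_ℝ ≤ 0 ∧ (0 ≤ ⟪ctr (weight cubic), ctr k⟫_ℝ → ctr k = 0) := by
  have hk' := (hk.add_const (-k (1 / 3))).sq_integrable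
  have hint := memLp_weight_cubic.sub (memLp_const (1 : ℝ)) |>.integrable_mul hk'
  have heq : ⟪ctr (weight cubic), ctr k⟫_ℝ =
      -∫ u, -((weight cubic u - 1) * (k u + -k (1 / 3))) ∂unif := by
    rw [← ctr_add_const hk.sq_integrable (-k (1 / 3)), inner_ctr_right (integral_ctr _) hk',
      integral_neg, neg_neg]
    refine integral_congr_ae ?_
    filter_upwards [coeFn_ctr_weight_cubic] with u hu
    rw [hu, weight_cubic]
    ring
  have hnn : ∀ᵐ u ∂unif, 0 ≤ -((weight cubic u - 1) * (k u + -k (1 / 3))) := by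
    filter_upwards [ae_unif_mem] with u hu
    have h3 : (1 / 3 : ℝ) ∈ Ioo (0 : ℝ) 1 := by constructor <;> norm_num
    rw [weight_cubic, ← neg_mul]
    rcases le_total u (1 / 3) with h | h
    · have h1 := hk.mono hu h3 h
      refine mul_nonneg_of_nonpos_of_nonpos ?_ (by linarith)
      nlinarith [hu.2]
    · have h1 := hk.mono h3 hu h
      refine mul_nonneg ?_ (by linarith)
      nlinarith [hu.2]
  have hge := integral_nonneg_of_ae hnn
  refine ⟨by rw [heq]; linarith, fun h => ?_⟩
  have hz : ∫ u, -((weight cubic u - 1) * (k u + -k (1 / 3))) ∂unif = 0 :=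
    le_antisymm (by rw [heq] at h; linarith) hge
  rw [integral_eq_zero_iff_of_nonneg_ae hnn hint.neg] at hz
  rw [← ctr_const (k (1 / 3))]
  refine ctr_congr ?_
  have hnull : NullSingletonClass unif := by unfold unif; infer_instance
  filter_upwards [hz, ae_unif_mem,
    measure_eq_zero_iff_ae_notMem.1 (measure_singleton (μ := unif) (1 / 3))] with u hu hmem hne
  rw [weight_cubic, Pi.zero_apply, neg_eq_zero, mul_eq_zero] at hu
  rcases hu with hu | hu
  · exfalso
    rw [add_sub_cancel_left, mul_eq_zero] at hu
    rcases hu with hu | hu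
    · linarith [hmem.2]
    · exact hne (by simp only [mem_singleton_iff]; linarith)
  · linarith

lemma isIsotonic_id : IsIsotonic (fun u => u) := by
  refine ⟨MemLp.of_bound measurable_id.aestronglyMeasurable 1 ?_, fun _ _ _ _ h => h,
    fun _ _ => continuousWithinAt_id⟩
  filter_upwards [ae_unif_mem] with u hu
  rw [Real.norm_eq_abs, abs_of_pos hu.1]
  exact hu.2.le

lemma law_id : law (fun u => u) = unif := Measure.map_id

lemma quantile_unif_ae_eq : quantile unif =ᵐ[unif] fun u => u := by
  have := quantile_law isIsotonic_id
  rw [law_id] at this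
  exact ae_unif_mem.mono this

lemma memLp_quantile_unif : MemLp (quantile unif) 2 unif :=
  isIsotonic_id.sq_integrable.ae_eq quantile_unif_ae_eq.symm

lemma hasMoments_unif : HasMoments unif (meanU fun u => u) (stdU fun u => u) := by
  have := hasMoments_law (σ := stdU fun u => u) isIsotonic_id.sq_integrable rfl (by
    rw [stdU, Real.sq_sqrt (variance_nonneg _ _)])
  rwa [law_id] at this

lemma stdU_id_pos : 0 < stdU fun u => u := by
  rw [stdU_eq isIsotonic_id.sq_integrable, norm_pos_iff, Ne, ← isIsotonic_id.isConstant_iff]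
  rintro ⟨c, hc⟩
  have h1 := hc (1 / 2) (by constructor <;> norm_num)
  have h2 := hc (1 / 3) (by constructor <;> norm_num)
  norm_num at h1 h2
  linarith

lemma integral_mul_indicator_Ioi (f : ℝ → ℝ) {a : ℝ} (h0 : 0 ≤ a) (h1 : a ≤ 1) :
    ∫ u, f u * (Ioi a).indicator 1 u ∂unif = ∫ u in a..1, f u := by
  have h : (fun u => f u * (Ioi a).indicator 1 u) = (Ioi a).indicator f := by
    funext u
    by_cases hu : a < u <;> simp [hu]
  rw [h, integral_indicator measurableSet_Ioi, unif, Measure.restrict_restrict measurableSet_Ioi,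
    intervalIntegral.integral_of_le h1, integral_Ioc_eq_integral_Ioo]
  congr 2
  ext u
  simp only [mem_inter_iff, mem_Ioi, mem_Ioo]
  constructor
  · rintro ⟨p, -, q⟩; exact ⟨p, q⟩
  · rintro ⟨p, q⟩; exact ⟨p, h0.trans_lt p, q⟩

lemma meanU_id : meanU (fun u => u) = 1 / 2 := by
  rw [meanU, unif, ← integral_Ioc_eq_integral_Ioo, ← intervalIntegral.integral_of_le zero_le_one,
    integral_id]
  norm_num

/-- The pairing of the tilted weight with the indicator of `(a, 1)`. -/
lemma inner_tilted_cubic_indicator (l : ℝ) {a : ℝ} (h0 : 0 ≤ a) (h1 : a ≤ 1) :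
    ⟪ctr (weight cubic) + l • ctr (quantile unif), ctr ((Ioi a).indicator 1)⟫_ℝ =
      a * (1 - a) * (l / 2 - (1 - a)) := by
  have hind : MemLp ((Ioi a).indicator (1 : ℝ → ℝ)) 2 unif :=
    memLp_of_bounded (c := 1) (measurable_one.indicator measurableSet_Ioi).aemeasurable fun u => by
      by_cases hu : a < u <;> simp [hu]
  have e1 : ⟪ctr (weight cubic), ctr ((Ioi a).indicator 1)⟫_ℝ =
      ∫ u in a..1, (1 - u) * (1 - 3 * u) := by
    rw [inner_ctr_right (integral_ctr _) hind, ← integral_mul_indicator_Ioi _ h0 h1]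
    refine integral_congr_ae ?_
    filter_upwards [coeFn_ctr_weight_cubic] with u hu
    rw [hu]
  have e2 : ⟪ctr (quantile unif), ctr ((Ioi a).indicator 1)⟫_ℝ = ∫ u in a..1, (u - 1 / 2) := by
    rw [ctr_congr quantile_unif_ae_eq, inner_ctr_right (integral_ctr _) hind,
      ← integral_mul_indicator_Ioi _ h0 h1]
    refine integral_congr_ae ?_
    filter_upwards [coeFn_ctr isIsotonic_id.sq_integrable] with u hu
    rw [hu, meanU_id]
  have f1 : ∫ u in a..1, (1 - u) * (1 - 3 * u) = 1 * (1 - 1) ^ 2 - a * (1 - a) ^ 2 := by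
    refine intervalIntegral.integral_eq_sub_of_hasDerivAt (f := fun u => u * (1 - u) ^ 2)
      (fun u _ => ?_) (Continuous.intervalIntegrable (by fun_prop) _ _)
    have := (hasDerivAt_id u).mul (((hasDerivAt_id u).const_sub 1).pow 2)
    convert! this using 1
    simp
    ring
  have f2 : ∫ u in a..1, (u - 1 / 2) = (1 ^ 2 - 1) / 2 - (a ^ 2 - a) / 2 := by
    refine intervalIntegral.integral_eq_sub_of_hasDerivAt (f := fun u => (u ^ 2 - u) / 2)
      (fun u _ => ?_) (Continuous.intervalIntegrable (by fun_prop) _ _)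
    have := ((hasDerivAt_pow 2 u).sub (hasDerivAt_id u)).div_const 2
    convert! this using 1
    simp
    ring
  rw [inner_add_left, inner_smul_left, e1, e2, f1, f2]
  simp only [conj_trivial]
  ring

/-- The pairing of `γ` with the step at `a` vanishes to second order as `a → 1`, that of `F⁻¹` only
to first order. An arbitrarily small tilt thus pairs positively with a step close enough to `1`,
which excludes a zero projection. -/
lemma ctr_kUp_cubic_ne_zero {l : ℝ} (hl : 0 < l) : ctr (kUp cubic unif l) ≠ 0 := by
  intro h0
  -- This makes `1 - a` smaller than `l / 2` while keeping `a` in `(0, 1)`.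
  set a : ℝ := 1 - min l 1 / 4 with ha
  have hm0 : 0 < min l 1 := lt_min hl one_pos
  have hm1 := min_le_left l 1
  have hm2 := min_le_right l 1
  have hind : MemLp ((Ioi a).indicator (1 : ℝ → ℝ)) 2 unif :=
    memLp_of_bounded (c := 1) (measurable_one.indicator measurableSet_Ioi).aemeasurable fun u => by
      by_cases hu : a < u <;> simp [hu]
  have hmono : Monotone ((Ioi a).indicator (1 : ℝ → ℝ)) := by
    intro u v huv
    by_cases hu : a < u
    · simp [hu, hu.trans_le huv]
    · by_cases hv : a < v <;> simp [hu, hv]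
  have h := (isConeProj_kUp memLp_weight_cubic memLp_quantile_unif l).inner_nonpos _
    (ctr_mem_isoCone (hmono.monotoneOn _) hind)
  rw [h0, sub_zero, inner_tilted_cubic_indicator l (by linarith) (by linarith)] at h
  have : 0 < a * (1 - a) * (l / 2 - (1 - a)) :=
    mul_pos (mul_pos (by linarith) (by linarith)) (by linarith)
  linarith

lemma isIsotonic_kUp_cubic (l : ℝ) : IsIsotonic (kUp cubic unif l) :=
  (isIsotonicProjection_kUp memLp_weight_cubic memLp_quantile_unif l).1

lemma isConstant_kUp_cubic_zero : IsConstant (kUp cubic unif 0) := by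
  rw [(isIsotonic_kUp_cubic 0).isConstant_iff]
  refine (isConeProj_kUp memLp_weight_cubic memLp_quantile_unif 0).unique
    ⟨isClosedConvexCone_isoCone.zero_mem, inner_zero_right _, fun w hw => ?_⟩
  obtain ⟨k, hk, rfl, -⟩ := exists_isotonic_of_mem_isoCone hw
  rw [zero_smul, add_zero, sub_zero]
  exact (inner_weight_cubic hk).1

lemma lambdaUp_cubic : lambdaUp cubic unif = 0 := by
  refine le_antisymm ?_ (le_sInf ?_)
  · by_contra! hlt
    obtain ⟨r, h1, h2⟩ := EReal.lt_iff_exists_real_btwn.1 hlt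
    have hr : 0 < r := by exact_mod_cast h1
    have hmem : r ∈ {l : ℝ | 0 ≤ l ∧ ¬ IsConstant (kUp cubic unif l)} :=
      ⟨hr.le, fun hc => ctr_kUp_cubic_ne_zero hr ((isIsotonic_kUp_cubic r).isConstant_iff.1 hc)⟩
    exact absurd (sInf_le (mem_image_of_mem _ hmem)) (not_le.2 h2)
  · rintro _ ⟨l, ⟨hl, -⟩, rfl⟩
    exact EReal.coe_nonneg.2 hl

lemma setting_cubic : Setting cubic unif (meanU fun u => u) (stdU fun u => u) where
  distortion := isDistortion_cubic
  abs_cont := absolutelyContinuous_cubic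
  weight_sq := memLp_weight_cubic
  weight_ne_one := ⟨1 / 2, by constructor <;> norm_num, by rw [weight_cubic]; norm_num⟩
  moments := hasMoments_unif
  sigma_pos := stdU_id_pos
  lambdaUp_eq := lambdaUp_cubic

/-- A maximiser would have value `μ`, hence a constant quantile function, contradicting `σ > 0`. -/
lemma worstDistributions_cubic {μ σ : ℝ} (hσ : 0 < σ) {ε : ℝ≥0∞}
    (hε : ENNReal.ofReal (upperCrit cubic unif (meanU fun u => u) (stdU fun u => u) μ σ) ≤ ε) :
    worstDistributions cubic unif μ σ ε = ∅ := by
  refine eq_empty_of_forall_notMem fun G hG => ?_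
  have hval := setting_cubic.case_constant hσ hε isConstant_kUp_cubic_zero
  have hle : (μ : EReal) ≤ riskMeasure cubic G := by
    rw [← hval]
    exact iSup₂_le hG.2
  rw [setting_cubic.riskMeasure_eq hG.1.1, EReal.coe_le_coe_iff] at hle
  have h0 := (inner_weight_cubic hG.1.1.isIsotonic).2 (by linarith)
  have hn := hG.1.1.norm_ctr_quantile hσ.le
  rw [h0, norm_zero] at hn
  exact hσ.ne hn

end WorstCase

theorem theorem2 (μ σ : ℝ) (hσ : 0 < σ) :
    (∀ (g : ℝ → ℝ) (F : Measure ℝ) (μF σF : ℝ), Setting g F μF σF →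
      -- the isotonic projections exist and are unique, and the limit `c₀` exists
      (∀ l : ℝ, 0 ≤ l →
        IsIsotonicProjection (tilted g F l) (kUp g F l) ∧
        ∀ k, IsIsotonicProjection (tilted g F l) k → EqOn k (kUp g F l) (Ioo 0 1)) ∧
      Tendsto (fun l : ℝ => corrU (quantile F) (kUp g F l)) (𝓝[>] 0) (𝓝 (cZero g F)) ∧
      -- case 1, with `Λ ε` the unique positive solution of `d_W(F⁻¹, h_l^↑) = √ε`
      (∃ Λ : ℝ≥0∞ → ℝ,
        (∀ ε : ℝ≥0∞, ENNReal.ofReal (lowerCrit μF σF μ σ) < ε →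
          ε < ENNReal.ofReal (upperCrit g F μF σF μ σ) →
          (0 < Λ ε ∧ dW F (law (hUp g F μ σ (Λ ε))) = ε ^ (1 / 2 : ℝ) ∧
            ∀ l : ℝ, 0 < l → dW F (law (hUp g F μ σ l)) = ε ^ (1 / 2 : ℝ) → l = Λ ε) ∧
          Solves g F μ σ ε (Λ ε)) ∧
        ContinuousOn (fun ε : ℝ≥0∞ => riskMeasure g (law (hUp g F μ σ (Λ ε))))
          (Ioo (ENNReal.ofReal (lowerCrit μF σF μ σ))
            (ENNReal.ofReal (upperCrit g F μF σF μ σ)))) ∧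
      -- case 2
      (∀ ε : ℝ≥0∞, ENNReal.ofReal (lowerCrit μF σF μ σ) < ε →
        ENNReal.ofReal (upperCrit g F μF σF μ σ) ≤ ε →
        (¬ IsConstant (kUp g F 0) → Solves g F μ σ ε 0) ∧
        (IsConstant (kUp g F 0) → worstValue g F μ σ ε = (μ : EReal)))) ∧
    -- in case 2 with `γ^↑` constant, the value need not be attained
    (∃ (g : ℝ → ℝ) (F : Measure ℝ) (μF σF : ℝ), Setting g F μF σF ∧ IsConstant (kUp g F 0) ∧
      ∀ ε : ℝ≥0∞, ENNReal.ofReal (lowerCrit μF σF μ σ) < ε →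
        ENNReal.ofReal (upperCrit g F μF σF μ σ) ≤ ε →
        worstDistributions g F μ σ ε = ∅) := by
  refine ⟨fun g F μF σF S => ⟨fun l _ => ⟨?_, fun k hk => ?_⟩, S.tendsto_cZero,
    S.case_binding hσ, fun ε _ hε => ⟨S.case_not_constant hσ hε, S.case_constant hσ hε⟩⟩,
    cubic, unif, _, _, setting_cubic, isConstant_kUp_cubic_zero,
    fun ε _ hε => worstDistributions_cubic hσ hε⟩
  · exact isIsotonicProjection_kUp S.weight_sq S.memLp_quantile l
  · exact hk.eqOn (memLp_tilted S.weight_sq S.memLp_quantile l)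
      (isIsotonicProjection_kUp S.weight_sq S.memLp_quantile l)
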